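/- Let $\Lambda\subset\mathbb R^n$ be a lattice of rank $n$. Write $(\cdot,\cdot)$ for the Euclidean inner product and call $(x,x)=\|x\|^2$ the norm of $x$. The lattice $\Lambda$ is \emph{unimodular} if $(x,y)\in\mathbb Z$ for all $x,y\in\Lambda$ and its determinant is $\pm1$ (equivalently, it has covolume $1$). Its theta function is $\Theta_\Lambda(\tau)=\sum_{x\in\Lambda}e^{\pi i\|x\|^2\tau}$, and its secrecy function is $\Xi_\Lambda(y)=\Theta_{\mathbb Z^n}(yi)/\Theta_\Lambda(yi)$ for real $y>0$. The \emph{Belfiore--Sol\'e conjecture} states that for every unimodular lattice $\Lambda$, in any dimension, $\Xi_\Lambda$ attains its maximum over $y>0$ at $y=1$. A vector $w\in\Lambda$ is \emph{characteristic} if $(w,v)\equiv(v,v)\pmod 2$ for all $v\in\Lambda$. An \emph{$n-8k$ lattice} is a unimodular lattice in dimension $n$ all of whose characteristic vectors have norm at least $n-8k$. **Theorem.** Assume the Belfiore--Sol\'e conjecture. Then for every $n\ge 12885$ there is no $n-40$ lattice in dimension $n$ (the case $k=5$) that has no nonzero vectors of norm $\le 3$. -/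

import Mathlib

open scoped InnerProductSpace

namespace BelfioreSole

/-- A full-rank lattice `Λ` in Euclidean `n`-space is (integral) unimodular if all its inner
products are integers and its covolume (the absolute value of the determinant of a generator
matrix) is `1`. -/
def IsUnimodular {n : ℕ} (Λ : Submodule ℤ (EuclideanSpace ℝ (Fin n)))
    [DiscreteTopology Λ] [IsZLattice ℝ Λ] : Prop :=
  (∀ x ∈ Λ, ∀ y ∈ Λ, ∃ m : ℤ, ⟪x, y⟫_ℝ = m) ∧ ZLattice.covolume Λ = 1

/-- The standard lattice `ℤⁿ`. -/
def intLattice (n : ℕ) : Submodule ℤ (EuclideanSpace ℝ (Fin n)) :=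
  Submodule.span ℤ (Set.range fun i : Fin n => EuclideanSpace.single i (1 : ℝ))

/-- The value at `τ = y i` (`y > 0`) of the theta function
`Θ_Λ(τ) = ∑_{x ∈ Λ} exp (π i ‖x‖² τ)`; it is the real number `∑_{x ∈ Λ} exp (-π ‖x‖² y)`. -/
noncomputable def theta {n : ℕ} (Λ : Submodule ℤ (EuclideanSpace ℝ (Fin n))) (y : ℝ) : ℝ :=
  ∑' x : Λ, Real.exp (-Real.pi * ‖(x : EuclideanSpace ℝ (Fin n))‖ ^ 2 * y)

/-- The secrecy function `Ξ_Λ(y) = Θ_{ℤⁿ}(y i) / Θ_Λ(y i)`. -/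
noncomputable def secrecyFunction {n : ℕ} (Λ : Submodule ℤ (EuclideanSpace ℝ (Fin n)))
    (y : ℝ) : ℝ :=
  theta (intLattice n) y / theta Λ y

/-- The Belfiore–Solé conjecture: the secrecy function of every unimodular lattice, in any
dimension, attains its maximum over `y > 0` at `y = 1`. -/
def BelfioreSoleConjecture : Prop :=
  ∀ (n : ℕ) (Λ : Submodule ℤ (EuclideanSpace ℝ (Fin n))) [DiscreteTopology Λ] [IsZLattice ℝ Λ],
    IsUnimodular Λ → IsMaxOn (secrecyFunction Λ) (Set.Ioi 0) 1

/-- `w ∈ Λ` is a characteristic vector of `Λ` if `(w, v) ≡ (v, v) (mod 2)` for all `v ∈ Λ`. -/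
def IsCharacteristic {n : ℕ} (Λ : Submodule ℤ (EuclideanSpace ℝ (Fin n)))
    (w : EuclideanSpace ℝ (Fin n)) : Prop :=
  w ∈ Λ ∧ ∀ v ∈ Λ, ∃ m : ℤ, ⟪w, v⟫_ℝ - ⟪v, v⟫_ℝ = 2 * m

/-- An `n - 8k` lattice: a unimodular lattice in dimension `n` all of whose characteristic vectors
have norm `(w, w)` at least `n - 8k`. -/
def IsNSubEightKLattice {n : ℕ} (k : ℕ) (Λ : Submodule ℤ (EuclideanSpace ℝ (Fin n)))
    [DiscreteTopology Λ] [IsZLattice ℝ Λ] : Prop :=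
  IsUnimodular Λ ∧ ∀ w, IsCharacteristic Λ w → (n : ℝ) - 8 * (k : ℝ) ≤ ⟪w, w⟫_ℝ

end BelfioreSole

/-! Write q = exp(πiτ). For an n − 8k lattice, Θ_Λ/θ₃ⁿ is a modular function for the theta group
(generated by τ ↦ τ + 2 and τ ↦ −1/τ) whose only possible pole is at the cusp 1. There it becomes
the theta series of the shadow, formed by the halves of the characteristic vectors, divided by θ₂ⁿ;
the lower bound on characteristic norms says exactly that the pole has order at most k. Hence Θ_Λ =
θ₃ⁿ P(`haupt`) with deg P ≤ k and `haupt` = q + O(q²): this is `exists_polynomial_translateTheta`.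

Let k = 5. The absence of norms 1, 2, 3 fixes coefficients 0 to 3 of P, and coefficient 4 is a
quartic in n with leading term 2n⁴/3, plus the number N of vectors of norm 4
(`coeff_eq_of_hasExpansion`). Coefficient 5 is −2⁶⁰μ, where 2ⁿμ counts the characteristic vectors of
norm n − 40. Two layers of the shadow, at its minimal norm and 2 above it, contain at most 2ⁿ
vectors together, since these are pairwise incongruent modulo 2Λ (`ncard_add_ncard_le`). The q²
coefficient of the shadow expresses the second layer through μ and coefficient 4, which yields μ(n −
119) ≤ 1.

The secrecy function tends to 1 at infinity, so the conjecture forces Θ_Λ(i) ≤ Θ_{ℤⁿ}(i), that is,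
P(1/64) ≤ 1, because `haupt` takes the value 1/64 at i. For n ≥ 12885 the n⁴ term outweighs −2³⁰μ
and P(1/64) > 1 (`one_lt_of_mul_sub_le_one`), a contradiction. -/

namespace BelfioreSole

/-! ### Modular functions of level one -/

open Complex Filter Topology
open UpperHalfPlane hiding I
open scoped MatrixGroups ModularForm Real

/-- A holomorphic function on the upper half plane that is invariant under `SL(2, ℤ)` and has a
limit at `i∞` is constant. -/
theorem eq_of_levelOne_of_tendsto {F : ℂ → ℂ} {c : ℂ}
    (hF : DifferentiableOn ℂ F {τ | 0 < τ.im})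
    (hT : ∀ τ : ℂ, 0 < τ.im → F (τ + 1) = F τ) (hS : ∀ τ : ℂ, 0 < τ.im → F (-1 / τ) = F τ)
    (hc : Tendsto F (comap im atTop) (𝓝 c)) {τ : ℂ} (hτ : 0 < τ.im) : F τ = c := by
  have hc' : Tendsto (fun τ : ℍ ↦ F τ) atImInfty (𝓝 c) :=
    hc.comp (tendsto_comap_iff.2 tendsto_comap)
  have hSs : (fun τ : ℍ ↦ F τ) ∣[(0 : ℤ)] ModularGroup.S = fun τ : ℍ ↦ F τ := by
    ext z
    rw [ModularForm.SL_slash_apply, UpperHalfPlane.modular_S_smul]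
    have := hS z z.2
    simpa [neg_div] using this
  have hTs : (fun τ : ℍ ↦ F τ) ∣[(0 : ℤ)] ModularGroup.T = fun τ : ℍ ↦ F τ := by
    ext z
    rw [ModularForm.SL_slash_apply, UpperHalfPlane.modular_T_smul]
    have := hT z z.2
    simpa [add_comm] using this
  let G : ModularForm 𝒮ℒ 0 :=
    { toFun := fun τ : ℍ ↦ F τ
      slash_action_eq' := fun A hA ↦ by
        obtain ⟨A, rfl⟩ := hA
        exact SlashInvariantForm.slash_action_generators_SL2Z hSs hTs A
      holo' := by
        rw [UpperHalfPlane.mdifferentiable_iff]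
        refine hF.congr fun z hz ↦ ?_
        simp [ofComplex_apply_of_im_pos hz]
      -- All cusps are equivalent under SL(2, ℤ), so invariance reduces boundedness to the limit at
      -- i∞.
      bdd_at_cusps' := fun hc ↦ by
        rw [Subgroup.IsArithmetic.isCusp_iff_isCusp_SL2Z] at hc
        rw [OnePoint.isBoundedAt_iff_forall_SL2Z hc]
        intro γ _
        rw [SlashInvariantForm.slash_action_generators_SL2Z hSs hTs]
        exact hc'.isBigO_one ℝ |>.trans (Asymptotics.isBigO_refl _ _) }
  obtain ⟨d, hd⟩ := ModularFormClass.levelOne_weight_zero_const G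
  have hd' : ∀ z : ℍ, F z = d := fun z ↦ congrFun hd z
  have : d = c := tendsto_nhds_unique (by simp only [hd']; exact tendsto_const_nhds) hc'
  rw [← this]
  exact hd' ⟨τ, hτ⟩

end BelfioreSole

/-! ### Exponential sums: convergence, holomorphy, decay at i∞ -/

namespace BelfioreSole

open Complex Filter Topology Asymptotics

theorem norm_cexp_pi_mul (τ : ℂ) (r : ℝ) :
    ‖cexp (Real.pi * I * τ * r)‖ = Real.exp (-Real.pi * τ.im * r) := by
  rw [Complex.norm_exp]
  congr 1
  simp

theorem isOpen_im_pos : IsOpen {τ : ℂ | 0 < τ.im} := isOpen_lt continuous_const continuous_im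

theorem eventually_im_ge (c : ℝ) : ∀ᶠ τ : ℂ in comap im atTop, c ≤ τ.im :=
  tendsto_comap.eventually (eventually_ge_atTop c)

theorem eventually_im_pos : ∀ᶠ τ : ℂ in comap im atTop, 0 < τ.im :=
  tendsto_comap.eventually (eventually_gt_atTop 0)

theorem tendsto_mul_I_comap_im : Tendsto (fun y : ℝ ↦ (y : ℂ) * I) atTop (comap im atTop) := by
  rw [tendsto_comap_iff]
  simpa [Function.comp_def] using! tendsto_id

theorem summable_cexp_of_summable {ι : Type*} {N : ι → ℝ}
    (hs : ∀ ε > 0, Summable fun x ↦ Real.exp (-Real.pi * ε * N x)) {τ : ℂ} (hτ : 0 < τ.im) :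
    Summable fun x ↦ cexp (Real.pi * I * τ * N x) := by
  refine Summable.of_norm ?_
  simpa only [norm_cexp_pi_mul] using hs _ hτ

theorem differentiableOn_tsum_cexp {ι : Type*} {N : ι → ℝ} (h0 : ∀ x, 0 ≤ N x)
    (hs : ∀ ε > 0, Summable fun x ↦ Real.exp (-Real.pi * ε * N x)) :
    DifferentiableOn ℂ (fun τ : ℂ ↦ ∑' x, cexp (Real.pi * I * τ * N x)) {τ | 0 < τ.im} := by
  intro τ hτ
  have hτ' : 0 < τ.im := hτ
  -- A uniform majorant exists only away from the real axis, hence the half-plane at half the height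
  -- of τ.
  have hopen : IsOpen {w : ℂ | τ.im / 2 < w.im} := isOpen_lt continuous_const continuous_im
  have := differentiableOn_tsum_of_summable_norm
    (F := fun x (τ : ℂ) ↦ cexp (Real.pi * I * τ * N x)) (hs (τ.im / 2) (by positivity))
    (fun x ↦ by fun_prop) hopen (fun x w hw ↦ by
      rw [norm_cexp_pi_mul]
      apply Real.exp_le_exp.2
      have h1 : τ.im / 2 ≤ w.im := le_of_lt hw
      have := mul_le_mul_of_nonneg_right h1 (mul_nonneg Real.pi_pos.le (h0 x))
      linarith)
  refine (this.differentiableAt (hopen.mem_nhds ?_)).differentiableWithinAt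
  change τ.im / 2 < τ.im
  linarith

/-- For im τ ≥ 1 one has (N x − c)(im τ − 1) ≥ 0, so each term is at most its size at height 1 times
exp(−πc(im τ − 1)). -/
theorem isBigO_tsum_cexp {ι : Type*} {N : ι → ℝ} {c : ℝ} (hc : ∀ x, c ≤ N x)
    (hs : ∀ ε > 0, Summable fun x ↦ Real.exp (-Real.pi * ε * N x)) :
    (fun τ : ℂ ↦ ∑' x, cexp (Real.pi * I * τ * N x)) =O[comap im atTop]
      fun τ ↦ Real.exp (-Real.pi * c * τ.im) := by
  refine IsBigO.of_bound (∑' x, Real.exp (-Real.pi * 1 * N x) * Real.exp (Real.pi * c)) ?_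
  filter_upwards [eventually_im_ge 1] with τ hτ
  have h1 : ∀ x, ‖cexp (Real.pi * I * τ * N x)‖ ≤
      Real.exp (-Real.pi * 1 * N x) * Real.exp (Real.pi * c) * Real.exp (-Real.pi * c * τ.im) := by
    intro x
    rw [norm_cexp_pi_mul, ← Real.exp_add, ← Real.exp_add]
    apply Real.exp_le_exp.2
    nlinarith [mul_nonneg (mul_nonneg Real.pi_pos.le (sub_nonneg.2 (hc x))) (sub_nonneg.2 hτ)]
  have hs1 := ((hs 1 one_pos).mul_right (Real.exp (Real.pi * c))).mul_right
    (Real.exp (-Real.pi * c * τ.im))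
  rw [Real.norm_of_nonneg (Real.exp_pos _).le, ← tsum_mul_right]
  exact tsum_of_norm_bounded hs1.hasSum h1

/-- A theta sum is the sum of its terms over a finite set up to the order of the next terms. -/
theorem isBigO_tsum_cexp_sub_sum {ι : Type*} {N : ι → ℝ} {c : ℝ} (s : Finset ι)
    (hc : ∀ x ∉ s, c ≤ N x) (hs : ∀ ε > 0, Summable fun x ↦ Real.exp (-Real.pi * ε * N x)) :
    (fun τ : ℂ ↦ ∑' x, cexp (Real.pi * I * τ * N x) - ∑ x ∈ s, cexp (Real.pi * I * τ * N x))
      =O[comap im atTop] fun τ ↦ Real.exp (-Real.pi * c * τ.im) := by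
  have := isBigO_tsum_cexp (N := fun x : {x // x ∉ s} ↦ N x) (fun x ↦ hc x x.2)
    (fun ε hε ↦ (hs ε hε).subtype _)
  refine this.congr' ?_ EventuallyEq.rfl
  filter_upwards [eventually_im_pos] with τ hτ
  rw [← (summable_cexp_of_summable hs hτ).sum_add_tsum_subtype_compl s, add_sub_cancel_left]

theorem tendsto_exp_neg_im {c : ℝ} (hc : 0 < c) :
    Tendsto (fun τ : ℂ ↦ Real.exp (-Real.pi * c * τ.im)) (comap im atTop) (𝓝 0) := by
  have h : Tendsto (fun t : ℝ ↦ Real.exp (-(Real.pi * c * t))) atTop (𝓝 0) :=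
    Real.tendsto_exp_neg_atTop_nhds_zero.comp
      (tendsto_id.const_mul_atTop (mul_pos Real.pi_pos hc))
  simpa [Function.comp_def] using h.comp (tendsto_comap (f := im) (x := atTop))

theorem im_neg_one_div_pos {τ : ℂ} (hτ : 0 < τ.im) : 0 < (-1 / τ).im := by
  have h0 : τ ≠ 0 := by rintro rfl; simp at hτ
  rw [neg_div, one_div, neg_im, inv_im, neg_div, neg_neg]
  exact div_pos hτ (normSq_pos.2 h0)

end BelfioreSole

/-! ### Jacobi theta constants and their transformations -/

namespace BelfioreSole

open Complex Filter Topology Asymptotics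

/-- The Jacobi theta function `θ₂`. -/
noncomputable def theta2 (τ : ℂ) : ℂ := cexp (Real.pi * I * τ / 4) * jacobiTheta₂ (τ / 2) τ

/-- The Jacobi theta function `θ₄`. -/
noncomputable def theta4 (τ : ℂ) : ℂ := jacobiTheta (τ + 1)

theorem jacobiTheta_add_one_eq (τ : ℂ) : jacobiTheta (τ + 1) = jacobiTheta₂ (1 / 2) τ := by
  rw [jacobiTheta_eq_jacobiTheta₂]
  refine tsum_congr fun n ↦ ?_
  simp only [jacobiTheta₂_term]
  rw [Complex.exp_eq_exp_iff_exists_int]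
  -- Since n² ≡ n mod 2, the signs (−1)^(n²) and (−1)^n agree.
  obtain ⟨k, hk⟩ := Int.even_mul_succ_self (n - 1)
  refine ⟨k, ?_⟩
  have hk' : (n : ℂ) ^ 2 - n = 2 * k := by
    have : n ^ 2 - n = 2 * k := by linear_combination hk
    exact_mod_cast this
  linear_combination Real.pi * I * hk'

theorem theta4_eq (τ : ℂ) : theta4 τ = jacobiTheta₂ (1 / 2) τ := jacobiTheta_add_one_eq τ

theorem theta4_add_one (τ : ℂ) : theta4 (τ + 1) = jacobiTheta τ := by
  rw [theta4, ← jacobiTheta_two_add τ]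
  congr 1
  ring

/-- Completing the square, (n + 1/2)² = 1/4 + n(n + 1); integral exponents remain after the factor
q^(1/4). -/
theorem theta2_eq_tsum (τ : ℂ) : theta2 τ = cexp (Real.pi * I * τ / 4) *
    ∑' n : ℤ, cexp (Real.pi * I * τ * ((n * (n + 1) : ℤ) : ℝ)) := by
  rw [theta2, jacobiTheta₂]
  congr 1
  refine tsum_congr fun n ↦ ?_
  rw [jacobiTheta₂_term]
  congr 1
  push_cast
  ring

theorem jacobiTheta_eq_tsum (τ : ℂ) :
    jacobiTheta τ = ∑' n : ℤ, cexp (Real.pi * I * τ * ((n ^ 2 : ℤ) : ℝ)) := by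
  refine tsum_congr fun n ↦ ?_
  congr 1
  push_cast
  ring

theorem theta2_add_one (τ : ℂ) : theta2 (τ + 1) = cexp (Real.pi * I / 4) * theta2 τ := by
  rw [theta2_eq_tsum, theta2_eq_tsum, ← mul_assoc, ← Complex.exp_add]
  congr 1
  · congr 1; ring
  · refine tsum_congr fun n ↦ ?_
    rw [Complex.exp_eq_exp_iff_exists_int]
    obtain ⟨k, hk⟩ := Int.even_mul_succ_self n
    refine ⟨k, ?_⟩
    rw [hk]
    push_cast
    ring

theorem ne_zero_of_im_pos {τ : ℂ} (hτ : 0 < τ.im) : τ ≠ 0 := by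
  rintro rfl; simp at hτ

theorem jacobiTheta_neg_one_div {τ : ℂ} (hτ : 0 < τ.im) :
    jacobiTheta (-1 / τ) = (-I * τ) ^ (1 / 2 : ℂ) * jacobiTheta τ := by
  have := jacobiTheta_S_smul ⟨τ, hτ⟩
  rw [UpperHalfPlane.modular_S_smul] at this
  simpa [neg_div] using this

theorem sqrt_factor_ne_zero {τ : ℂ} (hτ : 0 < τ.im) : (-I * τ) ^ (1 / 2 : ℂ) ≠ 0 := by
  have := ne_zero_of_im_pos hτ
  simp [cpow_eq_zero_iff, this]

theorem theta4_neg_one_div {τ : ℂ} (hτ : 0 < τ.im) :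
    theta4 (-1 / τ) = (-I * τ) ^ (1 / 2 : ℂ) * theta2 τ := by
  have h0 := ne_zero_of_im_pos hτ
  have h1 := sqrt_factor_ne_zero hτ
  rw [theta2, jacobiTheta₂_functional_equation, theta4_eq,
    show τ / 2 / τ = 1 / 2 by field_simp,
    show -(Real.pi : ℂ) * I * (τ / 2) ^ 2 / τ = -(Real.pi * I * τ / 4) by field_simp; norm_num]
  rw [Complex.exp_neg]
  field_simp [Complex.exp_ne_zero]

theorem theta2_neg_one_div {τ : ℂ} (hτ : 0 < τ.im) :
    theta2 (-1 / τ) = (-I * τ) ^ (1 / 2 : ℂ) * theta4 τ := by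
  have h0 := ne_zero_of_im_pos hτ
  have h1 := sqrt_factor_ne_zero hτ
  have h2 := theta4_neg_one_div (im_neg_one_div_pos hτ)
  have h3 : -1 / (-1 / τ) = τ := by field_simp
  have h4 : -I * (-1 / τ) = (-I * τ)⁻¹ := by
    rw [mul_inv, inv_neg, inv_I]; field_simp
  rw [h3, h4, inv_cpow] at h2
  · rw [h2, mul_inv_cancel_left₀ h1]
  -- The number −iτ lies in the right half-plane, off the branch cut, so the square root commutes
  -- with inversion.
  · have : 0 < (-I * τ).re := by simpa using hτ
    intro h
    have h5 := abs_arg_lt_pi_div_two_iff.2 (Or.inl this)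
    rw [h, abs_of_pos Real.pi_pos] at h5
    linarith [Real.pi_pos]

theorem sqrt_factor_pow_four {τ : ℂ} : ((-I * τ) ^ (1 / 2 : ℂ)) ^ 4 = -τ ^ 2 := by
  rw [← cpow_nat_mul, show ((4 : ℕ) : ℂ) * (1 / 2) = (2 : ℕ) by norm_num, cpow_natCast, mul_pow]
  simp

theorem differentiableOn_jacobiTheta : DifferentiableOn ℂ jacobiTheta {τ | 0 < τ.im} :=
  fun _ hτ ↦ (differentiableAt_jacobiTheta hτ).differentiableWithinAt

theorem differentiableOn_theta4 : DifferentiableOn ℂ theta4 {τ | 0 < τ.im} :=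
  differentiableOn_jacobiTheta.comp (f := fun τ ↦ τ + 1) (by fun_prop) fun τ hτ ↦ by
    simpa using hτ

/-- A geometric series in |n| dominates. The weak hypothesis on `N` covers both exponents n² and n(n
+ 1). -/
theorem summable_exp_of_le_abs {N : ℤ → ℝ} (hN : ∀ n : ℤ, |(n : ℝ)| - 1 ≤ N n) {ε : ℝ} (hε : 0 < ε) :
    Summable fun n ↦ Real.exp (-Real.pi * ε * N n) := by
  have h1 : Summable fun n : ℕ ↦ Real.exp (Real.pi * ε) * Real.exp (-(Real.pi * ε)) ^ n := by
    refine (summable_geometric_of_lt_one (Real.exp_pos _).le ?_).mul_left _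
    rw [Real.exp_lt_one_iff]
    have := Real.pi_pos
    nlinarith [mul_pos this hε]
  have h2 : ∀ n : ℤ, Real.exp (-Real.pi * ε * N n) ≤
      Real.exp (Real.pi * ε) * Real.exp (-(Real.pi * ε)) ^ n.natAbs := by
    intro n
    rw [← Real.exp_nat_mul, ← Real.exp_add]
    apply Real.exp_le_exp.2
    have h3 : ((n.natAbs : ℕ) : ℝ) = |(n : ℝ)| := by
      rw [Nat.cast_natAbs, Int.cast_abs]
    rw [h3]
    have := mul_le_mul_of_nonneg_left (hN n) (mul_pos Real.pi_pos hε).le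
    linarith
  refine Summable.of_nonneg_of_le (fun _ ↦ (Real.exp_pos _).le) h2 ?_
  refine Summable.of_nat_of_neg ?_ ?_ <;> simpa using h1

theorem abs_sub_one_le_sq (n : ℤ) : |(n : ℝ)| - 1 ≤ ((n ^ 2 : ℤ) : ℝ) := by
  push_cast
  rw [← sq_abs]
  nlinarith [sq_nonneg (|(n : ℝ)| - 1)]

theorem abs_sub_one_le_mul_succ (n : ℤ) : |(n : ℝ)| - 1 ≤ ((n * (n + 1) : ℤ) : ℝ) := by
  have h : |n| - 1 ≤ n * (n + 1) := by
    rcases abs_cases n with h | h <;> nlinarith [sq_nonneg (n + 1)]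
  exact_mod_cast h

theorem differentiableOn_theta2 : DifferentiableOn ℂ theta2 {τ | 0 < τ.im} := by
  have h := differentiableOn_tsum_cexp (N := fun n : ℤ ↦ ((n * (n + 1) : ℤ) : ℝ))
    (fun n ↦ by
      have : 0 ≤ n * (n + 1) := by
        rcases le_or_gt 0 n with h | h <;> nlinarith
      exact_mod_cast this)
    (fun ε hε ↦ summable_exp_of_le_abs abs_sub_one_le_mul_succ hε)
  rw [funext theta2_eq_tsum]
  exact DifferentiableOn.mul (by fun_prop) h

/-- `θ₃ = 1 + 2q + 2q⁴ + O(q⁵)` with `q = exp (π i τ)`. -/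
theorem isBigO_jacobiTheta_sub :
    (fun τ : ℂ ↦ jacobiTheta τ -
      (1 + 2 * cexp (Real.pi * I * τ) + 2 * cexp (Real.pi * I * τ) ^ 4)) =O[comap im atTop]
      fun τ ↦ Real.exp (-Real.pi * 5 * τ.im) := by
  have h := isBigO_tsum_cexp_sub_sum (N := fun n : ℤ ↦ ((n ^ 2 : ℤ) : ℝ)) (c := 5)
    -- The remaining n have n² ≥ 9; order 5 is all that is kept.
    {0, 1, -1, 2, -2} (fun n hn ↦ by
      have h3 : n ≤ -3 ∨ 3 ≤ n := by simp at hn; omega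
      have : 5 ≤ n ^ 2 := by rcases h3 with h | h <;> nlinarith
      exact_mod_cast this)
    (fun ε hε ↦ summable_exp_of_le_abs abs_sub_one_le_sq hε)
  refine h.congr_left fun τ ↦ ?_
  rw [← jacobiTheta_eq_tsum]
  congr 1
  simp [← Complex.exp_nat_mul]
  ring_nf

/-- `θ₂ = 2 q^(1/4) (1 + q² + O(q⁶))` with `q = exp (π i τ)`. -/
theorem isBigO_theta2_sub :
    (fun τ : ℂ ↦ cexp (-(Real.pi * I * τ / 4)) * theta2 τ - 2 * (1 + cexp (Real.pi * I * τ) ^ 2))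
      =O[comap im atTop] fun τ ↦ Real.exp (-Real.pi * 6 * τ.im) := by
  have h := isBigO_tsum_cexp_sub_sum (N := fun n : ℤ ↦ ((n * (n + 1) : ℤ) : ℝ)) (c := 6)
    -- Here n(n + 1) is 0, 2, 0, 2 respectively, and at least 6 for every other n.
    {0, 1, -1, -2} (fun n hn ↦ by
      have h3 : n ≤ -3 ∨ 2 ≤ n := by simp at hn; omega
      have : 6 ≤ n * (n + 1) := by rcases h3 with h | h <;> nlinarith
      exact_mod_cast this)
    (fun ε hε ↦ summable_exp_of_le_abs abs_sub_one_le_mul_succ hε)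
  refine h.congr_left fun τ ↦ ?_
  rw [theta2_eq_tsum, ← mul_assoc, ← Complex.exp_add, neg_add_cancel, Complex.exp_zero, one_mul]
  congr 1
  simp [← Complex.exp_nat_mul]
  ring_nf

end BelfioreSole

/-! ### The discriminant, nonvanishing of theta constants, Jacobi's identity -/

namespace BelfioreSole

open Complex Filter Topology Asymptotics

theorem tendsto_cexp_pi_I_mul :
    Tendsto (fun τ : ℂ ↦ cexp (Real.pi * I * τ)) (comap im atTop) (𝓝 0) := by
  rw [tendsto_zero_iff_norm_tendsto_zero]
  have := tendsto_exp_neg_im one_pos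
  refine this.congr fun τ ↦ ?_
  rw [Complex.norm_exp]
  simp

theorem tendsto_jacobiTheta : Tendsto jacobiTheta (comap im atTop) (𝓝 1) := by
  have h := isBigO_jacobiTheta_sub.trans_tendsto (tendsto_exp_neg_im (by norm_num : (0 : ℝ) < 5))
  have h2 := (tendsto_cexp_pi_I_mul.const_mul 2).add ((tendsto_cexp_pi_I_mul.pow 4).const_mul 2)
  have := (h.add h2).add_const 1
  simp only [mul_zero, zero_add, ne_eq, OfNat.ofNat_ne_zero, not_false_eq_true, zero_pow] at this
  refine this.congr fun τ ↦ ?_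
  ring

theorem tendsto_add_one_comap_im :
    Tendsto (fun τ : ℂ ↦ τ + 1) (comap im atTop) (comap im atTop) := by
  rw [tendsto_comap_iff]
  simpa [Function.comp_def] using! tendsto_comap (f := im) (x := atTop)

theorem tendsto_theta4 : Tendsto theta4 (comap im atTop) (𝓝 1) :=
  tendsto_jacobiTheta.comp tendsto_add_one_comap_im

theorem tendsto_theta2 :
    Tendsto (fun τ : ℂ ↦ cexp (-(Real.pi * I * τ / 4)) * theta2 τ) (comap im atTop) (𝓝 2) := by
  have h := isBigO_theta2_sub.trans_tendsto (tendsto_exp_neg_im (by norm_num : (0 : ℝ) < 6))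
  have h2 := ((tendsto_cexp_pi_I_mul.pow 2).const_add 1).const_mul 2
  have := h.add h2
  simp only [add_zero, mul_one, zero_add, ne_eq, OfNat.ofNat_ne_zero, not_false_eq_true,
    zero_pow] at this
  refine this.congr fun τ ↦ ?_
  ring

/-- The modular discriminant, as a function on `ℂ`. -/
noncomputable def disc (τ : ℂ) : ℂ := ModularForm.eta τ ^ 24

theorem disc_ne_zero {τ : ℂ} (hτ : 0 < τ.im) : disc τ ≠ 0 :=
  ModularForm.discriminant_ne_zero ⟨τ, hτ⟩

theorem disc_smul {τ : ℂ} (hτ : 0 < τ.im) (γ : Matrix.SpecialLinearGroup (Fin 2) ℤ) :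
    disc (γ • (⟨τ, hτ⟩ : UpperHalfPlane) : UpperHalfPlane) =
      UpperHalfPlane.denom γ (⟨τ, hτ⟩ : UpperHalfPlane) ^ 12 * disc τ := by
  have h := SlashInvariantForm.slash_action_generators_SL2Z
    ModularForm.discriminant_S_invariant ModularForm.discriminant_T_invariant γ
  have h1 := congrFun h ⟨τ, hτ⟩
  rw [ModularForm.SL_slash_apply] at h1
  have h2 := UpperHalfPlane.denom_ne_zero γ (⟨τ, hτ⟩ : UpperHalfPlane)
  change disc _ * _ = disc τ at h1
  rw [← h1, zpow_neg, mul_comm, mul_assoc]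
  rw [show (12 : ℤ) = ((12 : ℕ) : ℤ) from rfl, zpow_natCast, inv_mul_cancel₀ (pow_ne_zero _ h2),
    mul_one]

theorem disc_add_one {τ : ℂ} (hτ : 0 < τ.im) : disc (τ + 1) = disc τ := by
  have := disc_smul hτ ModularGroup.T
  have h1 (z : UpperHalfPlane) : UpperHalfPlane.denom ModularGroup.T z = 1 := by
    rw [ModularGroup.denom_apply]
    simp [ModularGroup.T]
  rw [UpperHalfPlane.modular_T_smul, h1] at this
  simpa [add_comm] using this

theorem disc_neg_one_div {τ : ℂ} (hτ : 0 < τ.im) : disc (-1 / τ) = τ ^ 12 * disc τ := by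
  have := disc_smul hτ ModularGroup.S
  rw [UpperHalfPlane.modular_S_smul, ModularGroup.denom_S] at this
  simpa [neg_div] using this

theorem differentiableOn_disc : DifferentiableOn ℂ disc {τ | 0 < τ.im} := fun _ hτ ↦
  ((ModularForm.differentiableAt_eta_of_mem_upperHalfPlaneSet hτ).pow 24).differentiableWithinAt

theorem tendsto_disc :
    Tendsto (fun τ : ℂ ↦ cexp (-(2 * Real.pi * I * τ)) * disc τ) (comap im atTop) (𝓝 1) := by
  have h := ModularForm.tendsto_atImInfty_tprod_one_sub_eta_q_pow.comp
    UpperHalfPlane.tendsto_comap_im_ofComplex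
  refine h.congr' ?_
  filter_upwards [eventually_im_pos] with τ hτ
  have := ModularForm.discriminant_eq_q_prod ⟨τ, hτ⟩
  rw [Function.comp_apply, UpperHalfPlane.ofComplex_apply_of_im_pos hτ]
  change disc τ = _ at this
  rw [this, Function.Periodic.qParam, ← mul_assoc, ← Complex.exp_add]
  simp

theorem exp_pi_mul_I_div_four_pow_eight : cexp (Real.pi * I / 4) ^ 8 = 1 := by
  rw [← Complex.exp_nat_mul, ← Complex.exp_two_pi_mul_I]
  congr 1
  push_cast; ring

theorem exp_pi_mul_I_div_four_pow_four : cexp (Real.pi * I / 4) ^ 4 = -1 := by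
  rw [← Complex.exp_nat_mul, ← Complex.exp_pi_mul_I]
  congr 1
  push_cast; ring

/-- The product of the three theta constants is a constant multiple of a power of `η`. -/
theorem theta_mul_pow_eight {τ : ℂ} (hτ : 0 < τ.im) :
    (theta2 τ * jacobiTheta τ * theta4 τ) ^ 8 = 256 * disc τ := by
  -- Up to the weight factor, τ ↦ −1/τ swaps θ₂ and θ₄ and fixes θ₃; τ ↦ τ + 1 swaps θ₃ and θ₄ and
  -- multiplies θ₂ by an eighth root of unity. The eighth power removes that root and has weight 12.
  -- The limit 256 = 2⁸ comes from θ₂ ~ 2q^(1/4).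
  have h := eq_of_levelOne_of_tendsto (c := 256)
    (F := fun τ ↦ (theta2 τ * jacobiTheta τ * theta4 τ) ^ 8 / disc τ) ?_ ?_ ?_ ?_ hτ
  · exact (div_eq_iff (disc_ne_zero hτ)).1 h
  · exact (((differentiableOn_theta2.mul differentiableOn_jacobiTheta).mul
      differentiableOn_theta4).pow 8).div differentiableOn_disc fun τ hτ ↦ disc_ne_zero hτ
  · intro τ hτ
    rw [disc_add_one hτ, theta2_add_one, theta4_add_one, ← theta4]
    simp only [mul_pow, exp_pi_mul_I_div_four_pow_eight]
    ring
  · intro τ hτ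
    have h0 := ne_zero_of_im_pos hτ
    rw [disc_neg_one_div hτ, theta2_neg_one_div hτ, theta4_neg_one_div hτ,
      jacobiTheta_neg_one_div hτ]
    have h4 := sqrt_factor_pow_four (τ := τ)
    generalize (-I * τ) ^ (1 / 2 : ℂ) = w at h4
    have h5 : (w * theta4 τ * (w * jacobiTheta τ) * (w * theta2 τ)) ^ 8 =
      (w ^ 4) ^ 6 * (theta2 τ * jacobiTheta τ * theta4 τ) ^ 8 := by ring
    rw [h5, h4]
    have := disc_ne_zero hτ
    field_simp
  · have h1 := (((tendsto_theta2.mul tendsto_jacobiTheta).mul tendsto_theta4).pow 8).div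
      tendsto_disc one_ne_zero
    norm_num at h1
    refine h1.congr fun τ ↦ ?_
    rw [Pi.div_apply]
    have h2 : cexp (-(2 * Real.pi * I * τ)) = cexp (-(Real.pi * I * τ / 4)) ^ 8 := by
      rw [← Complex.exp_nat_mul]; congr 1; push_cast; ring
    rw [h2]
    have := Complex.exp_ne_zero (-(Real.pi * I * τ / 4))
    simp only [mul_pow]
    field_simp

/-- Nonvanishing of the discriminant passes to each theta constant, which justifies all later
divisions by θ₂ and θ₃. -/
theorem theta_mul_ne_zero {τ : ℂ} (hτ : 0 < τ.im) : theta2 τ * jacobiTheta τ * theta4 τ ≠ 0 := by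
  intro h
  have := theta_mul_pow_eight hτ
  rw [h] at this
  simp [disc_ne_zero hτ] at this

theorem jacobiTheta_ne_zero {τ : ℂ} (hτ : 0 < τ.im) : jacobiTheta τ ≠ 0 :=
  right_ne_zero_of_mul (left_ne_zero_of_mul (theta_mul_ne_zero hτ))

theorem theta2_ne_zero {τ : ℂ} (hτ : 0 < τ.im) : theta2 τ ≠ 0 :=
  left_ne_zero_of_mul (left_ne_zero_of_mul (theta_mul_ne_zero hτ))

theorem cexp_add_one (τ : ℂ) : cexp (Real.pi * I * (τ + 1)) = -cexp (Real.pi * I * τ) := by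
  rw [mul_add, Complex.exp_add, mul_one, Complex.exp_pi_mul_I, mul_neg_one]

/-- Jacobi's identity between the fourth powers of the theta constants. -/
theorem jacobiTheta_pow_four {τ : ℂ} (hτ : 0 < τ.im) :
    jacobiTheta τ ^ 4 = theta2 τ ^ 4 + theta4 τ ^ 4 := by
  -- The difference J = θ₃⁴ − θ₂⁴ − θ₄⁴ is sent to −J by τ ↦ τ + 1 and to −τ²J by τ ↦ −1/τ, so J⁶
  -- divided by the discriminant has level one. As J = O(q) and the discriminant is of order q², the
  -- quotient tends to 0.
  have h := eq_of_levelOne_of_tendsto (c := 0)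
    (F := fun τ ↦ (jacobiTheta τ ^ 4 - theta2 τ ^ 4 - theta4 τ ^ 4) ^ 6 / disc τ) ?_ ?_ ?_ ?_ hτ
  · have := eq_zero_of_pow_eq_zero ((div_eq_zero_iff.1 h).resolve_right (disc_ne_zero hτ))
    linear_combination this
  · exact ((((differentiableOn_jacobiTheta.pow 4).sub (differentiableOn_theta2.pow 4)).sub
      (differentiableOn_theta4.pow 4)).pow 6).div differentiableOn_disc
      fun τ hτ ↦ disc_ne_zero hτ
  · intro τ hτ
    rw [disc_add_one hτ, theta2_add_one, theta4_add_one, ← theta4]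
    simp only [mul_pow, exp_pi_mul_I_div_four_pow_four]
    ring
  · intro τ hτ
    have h0 := ne_zero_of_im_pos hτ
    rw [disc_neg_one_div hτ, theta2_neg_one_div hτ, theta4_neg_one_div hτ,
      jacobiTheta_neg_one_div hτ]
    simp only [mul_pow, sqrt_factor_pow_four]
    have := disc_ne_zero hτ
    field_simp
    ring
  · have hq : ∀ c ≥ (1 : ℝ), (fun τ : ℂ ↦ Real.exp (-Real.pi * c * τ.im)) =O[comap im atTop]
        fun τ ↦ cexp (Real.pi * I * τ) := by
      intro c hc
      refine IsBigO.of_bound 1 ?_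
      filter_upwards [eventually_im_pos] with τ hτ
      rw [Complex.norm_exp, Real.norm_of_nonneg (Real.exp_pos _).le, one_mul]
      apply Real.exp_le_exp.2
      have := mul_le_mul_of_nonneg_right hc (mul_pos Real.pi_pos hτ).le
      simp
      linarith
    have hp : ∀ k : ℕ, (fun τ : ℂ ↦ cexp (Real.pi * I * τ) ^ (k + 1)) =O[comap im atTop]
        fun τ ↦ cexp (Real.pi * I * τ) := by
      intro k
      simpa [pow_succ'] using (isBigO_refl (fun τ : ℂ ↦ cexp (Real.pi * I * τ)) _).mul
        ((tendsto_cexp_pi_I_mul.pow k).isBigO_one ℂ)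
    have h3 : (fun τ ↦ jacobiTheta τ - 1) =O[comap im atTop] fun τ ↦ cexp (Real.pi * I * τ) := by
      have := ((isBigO_jacobiTheta_sub.trans (hq 5 (by norm_num))).add
        ((hp 0).const_mul_left 2)).add ((hp 3).const_mul_left 2)
      refine this.congr_left fun τ ↦ ?_
      ring
    have h4 : (fun τ ↦ theta4 τ - 1) =O[comap im atTop] fun τ ↦ cexp (Real.pi * I * τ) := by
      have := (h3.comp_tendsto tendsto_add_one_comap_im).neg_right
      simpa [Function.comp_def, cexp_add_one] using! this
    have hpow : ∀ {f : ℂ → ℂ}, Tendsto f (comap im atTop) (𝓝 1) →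
        (fun τ ↦ f τ - 1) =O[comap im atTop] (fun τ ↦ cexp (Real.pi * I * τ)) →
        (fun τ ↦ f τ ^ 4 - 1) =O[comap im atTop] fun τ ↦ cexp (Real.pi * I * τ) := by
      intro f hf hf1
      have := hf1.mul ((((hf.pow 3).add (hf.pow 2)).add (hf.add_const 1)).isBigO_one ℂ)
      simp only [mul_one] at this
      refine this.congr_left fun τ ↦ ?_
      ring
    have h2 : (fun τ ↦ theta2 τ ^ 4) =O[comap im atTop] fun τ ↦ cexp (Real.pi * I * τ) := by
      have := (isBigO_refl (fun τ : ℂ ↦ cexp (Real.pi * I * τ)) (comap im atTop)).mul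
        ((tendsto_theta2.pow 4).isBigO_one ℂ)
      simp only [mul_one] at this
      refine this.congr_left fun τ ↦ ?_
      rw [mul_pow, ← mul_assoc, ← Complex.exp_nat_mul, ← Complex.exp_add]
      ring_nf
      simp
    have h5 := ((((hpow tendsto_jacobiTheta h3).sub h2).sub (hpow tendsto_theta4 h4)).pow 6).mul
      ((tendsto_disc.inv₀ one_ne_zero).isBigO_one ℂ)
    simp only [mul_one] at h5
    have h6 := (isBigO_refl (fun τ : ℂ ↦ cexp (-(2 * Real.pi * I * τ))) (comap im atTop)).mul h5
    have h7 : Tendsto (fun τ : ℂ ↦ cexp (-(2 * Real.pi * I * τ)) * cexp (Real.pi * I * τ) ^ 6)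
        (comap im atTop) (𝓝 0) := by
      have := tendsto_cexp_pi_I_mul.pow 4
      simp only [ne_eq, OfNat.ofNat_ne_zero, not_false_eq_true, zero_pow] at this
      refine this.congr fun τ ↦ ?_
      simp only [← Complex.exp_nat_mul, ← Complex.exp_add]
      congr 1
      push_cast; ring
    refine (h6.trans_tendsto h7).congr fun τ ↦ ?_
    have := Complex.exp_ne_zero (-(2 * Real.pi * I * τ))
    rw [mul_inv]
    field_simp
    ring

end BelfioreSole

/-! ### Modular functions for the theta group and their Hauptmodul -/

namespace BelfioreSole

open Complex Filter Topology Asymptotics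

theorem isPreconnected_im_pos : IsPreconnected {τ : ℂ | 0 < τ.im} :=
  (convex_halfSpace_im_gt 0).isPreconnected

theorem im_one_sub_one_div_pos {τ : ℂ} (hτ : 0 < τ.im) : 0 < (1 - 1 / τ).im := by
  have := im_neg_one_div_pos hτ
  rw [neg_div] at this
  simpa [sub_eq_add_neg] using this

theorem im_add_one_pos {τ : ℂ} (hτ : 0 < τ.im) : 0 < (τ + 1).im := by simpa using hτ

theorem differentiableOn_comp_add_one {g : ℂ → ℂ} (hg : DifferentiableOn ℂ g {τ | 0 < τ.im}) :
    DifferentiableOn ℂ (fun τ ↦ g (τ + 1)) {τ | 0 < τ.im} :=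
  hg.comp (f := fun τ ↦ τ + 1) (by fun_prop) fun _ hτ ↦ im_add_one_pos hτ

theorem differentiableOn_comp_one_sub_one_div {g : ℂ → ℂ}
    (hg : DifferentiableOn ℂ g {τ | 0 < τ.im}) :
    DifferentiableOn ℂ (fun τ ↦ g (1 - 1 / τ)) {τ | 0 < τ.im} :=
  hg.comp (f := fun τ ↦ 1 - 1 / τ)
    (by
      refine DifferentiableOn.sub (by fun_prop) (DifferentiableOn.div (by fun_prop) (by fun_prop) ?_)
      exact fun τ hτ ↦ ne_zero_of_im_pos hτ)
    fun _ hτ ↦ im_one_sub_one_div_pos hτ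

/-- The translate by `1` of `τ ↦ g (1 - 1 / τ)`, for `g` invariant under `τ ↦ τ + 2` and
`τ ↦ -1 / τ`. -/
theorem comp_one_sub_one_div_add_one {g : ℂ → ℂ} (h2 : ∀ τ : ℂ, 0 < τ.im → g (τ + 2) = g τ)
    (hS : ∀ τ : ℂ, 0 < τ.im → g (-1 / τ) = g τ) {τ : ℂ} (hτ : 0 < τ.im) :
    g (1 - 1 / (τ + 1)) = g (1 - 1 / τ) := by
  have h0 := ne_zero_of_im_pos hτ
  have h1 := ne_zero_of_im_pos (im_add_one_pos hτ)
  have h3 := im_one_sub_one_div_pos (im_add_one_pos hτ)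
  have h4 : -1 / (1 - 1 / (τ + 1)) = -1 - 1 / τ := by
    have : 1 - 1 / (τ + 1) = τ / (τ + 1) := by field_simp; ring
    rw [this]
    field_simp
    ring
  have h5 := im_neg_one_div_pos h3
  rw [← hS _ h3, ← h2 _ h5, h4]
  congr 1
  ring

/-- A holomorphic function on the upper half plane that is invariant under `τ ↦ τ + 2` and
`τ ↦ -1 / τ`, bounded at the cusp `i∞` and vanishing at the cusp `1` is zero. -/
theorem eq_zero_of_thetaGroup {g : ℂ → ℂ} (hg : DifferentiableOn ℂ g {τ | 0 < τ.im})
    (h2 : ∀ τ : ℂ, 0 < τ.im → g (τ + 2) = g τ) (hS : ∀ τ : ℂ, 0 < τ.im → g (-1 / τ) = g τ)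
    (hb : g =O[comap im atTop] (1 : ℂ → ℂ))
    (h0 : Tendsto (fun τ ↦ g (1 - 1 / τ)) (comap im atTop) (𝓝 0)) {τ : ℂ} (hτ : 0 < τ.im) :
    g τ = 0 := by
  have hd1 := differentiableOn_comp_add_one hg
  have hd2 := differentiableOn_comp_one_sub_one_div hg
  -- The theta group has index 3 in the modular group, with cosets represented by τ, τ + 1 and 1 −
  -- 1/τ. The product over cosets is of level one and tends to 0; the identity theorem then makes
  -- one factor vanish identically.
  have hF : ∀ τ : ℂ, 0 < τ.im → g τ * g (τ + 1) * g (1 - 1 / τ) = 0 := by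
    intro τ hτ
    refine eq_of_levelOne_of_tendsto (F := fun τ ↦ g τ * g (τ + 1) * g (1 - 1 / τ))
      ((hg.mul hd1).mul hd2) (fun τ hτ ↦ ?_) (fun τ hτ ↦ ?_) ?_ hτ
    · rw [comp_one_sub_one_div_add_one h2 hS hτ, add_assoc, one_add_one_eq_two, h2 τ hτ,
        mul_comm (g (τ + 1))]
    · have e1 : -1 / τ + 1 = 1 - 1 / τ := by ring
      have e2 : 1 - 1 / (-1 / τ) = τ + 1 := by
        have := ne_zero_of_im_pos hτ
        field_simp
        ring
      rw [hS τ hτ, e1, e2, mul_right_comm]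
    · have hb2 : (fun τ ↦ g (τ + 1)) =O[comap im atTop] (1 : ℂ → ℂ) :=
        hb.comp_tendsto tendsto_add_one_comap_im
      have := (hb.mul hb2).mul (isBigO_refl (fun τ ↦ g (1 - 1 / τ)) (comap im atTop))
      refine this.trans_tendsto ?_
      simpa using h0
  have A1 := hg.analyticOnNhd isOpen_im_pos
  have A2 := hd1.analyticOnNhd isOpen_im_pos
  have A3 := hd2.analyticOnNhd isOpen_im_pos
  rcases AnalyticOnNhd.eq_zero_or_eq_zero_of_mul_eq_zero (A1.mul A2) A3 hF
    isPreconnected_im_pos with h | h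
  · rcases AnalyticOnNhd.eq_zero_or_eq_zero_of_mul_eq_zero A1 A2 h isPreconnected_im_pos with h | h
    · exact h τ hτ
    · rw [← h2 τ hτ, ← one_add_one_eq_two, ← add_assoc]
      exact h _ (im_add_one_pos hτ)
  · have h1 := im_add_one_pos hτ
    have h3 := ne_zero_of_im_pos h1
    have h4 := h _ (im_neg_one_div_pos h1)
    rw [← h2 τ hτ, ← h4]
    congr 1
    field_simp
    ring

/-- A holomorphic function of period `1` that is bounded at `i∞` has a limit there. -/
theorem exists_isBigO_sub_of_periodic {h : ℂ → ℂ} (hd : DifferentiableOn ℂ h {τ | 0 < τ.im})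
    (h1 : ∀ τ : ℂ, 0 < τ.im → h (τ + 1) = h τ) (hb : h =O[comap im atTop] (1 : ℂ → ℂ)) :
    ∃ L : ℂ, (fun τ ↦ h τ - L) =O[comap im atTop] fun τ ↦ cexp (2 * Real.pi * I * τ) := by
  classical
  -- Extension by zero turns periodicity on the half-plane into periodicity on all of ℂ.
  set H : ℂ → ℂ := Set.indicator {τ : ℂ | 0 < τ.im} h with hH
  have hHh : H =ᶠ[comap im atTop] h := by
    filter_upwards [eventually_im_pos] with τ hτ
    exact Set.indicator_of_mem (s := {τ : ℂ | 0 < τ.im}) hτ h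
  have hper : Function.Periodic H ((1 : ℝ) : ℂ) := by
    intro τ
    by_cases hτ : 0 < τ.im
    · have hτ1 : τ + ((1 : ℝ) : ℂ) ∈ {τ : ℂ | 0 < τ.im} := by simpa using hτ
      rw [hH, Set.indicator_of_mem hτ1, Set.indicator_of_mem (s := {τ : ℂ | 0 < τ.im}) hτ]
      simpa using h1 τ hτ
    · have hτ1 : τ + ((1 : ℝ) : ℂ) ∉ {τ : ℂ | 0 < τ.im} := by simpa using hτ
      rw [hH, Set.indicator_of_notMem hτ1, Set.indicator_of_notMem (s := {τ : ℂ | 0 < τ.im}) hτ]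
  have hdiff : ∀ᶠ τ in comap im atTop, DifferentiableAt ℂ H τ := by
    filter_upwards [eventually_im_pos] with τ hτ
    refine (hd.differentiableAt (isOpen_im_pos.mem_nhds hτ)).congr_of_eventuallyEq ?_
    filter_upwards [isOpen_im_pos.mem_nhds hτ] with w hw
    exact Set.indicator_of_mem (s := {τ : ℂ | 0 < τ.im}) hw h
  have hbd : BoundedAtFilter (comap im atTop) H := by
    have : H =O[comap im atTop] (1 : ℂ → ℂ) := hHh.trans_isBigO hb
    exact this.trans (isBigO_of_le _ fun τ ↦ by simp)
  have := Function.Periodic.exp_decay_sub_of_bounded_at_inf one_pos hper hdiff hbd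
  refine ⟨_, (this.congr' (hHh.sub EventuallyEq.rfl) EventuallyEq.rfl).trans
    (isBigO_of_le _ fun τ ↦ ?_)⟩
  rw [Complex.norm_exp, Real.norm_of_nonneg (Real.exp_pos _).le]
  apply le_of_eq
  congr 1
  simp

theorem tendsto_cexp_two_pi_I_mul :
    Tendsto (fun τ : ℂ ↦ cexp (2 * Real.pi * I * τ)) (comap im atTop) (𝓝 0) := by
  have := tendsto_cexp_pi_I_mul.pow 2
  simp only [ne_eq, OfNat.ofNat_ne_zero, not_false_eq_true, zero_pow] at this
  refine this.congr fun τ ↦ ?_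
  rw [← Complex.exp_nat_mul]
  congr 1
  push_cast; ring

/-- A periodic function with a pole of order at most `k` at `i∞` agrees up to a function
vanishing at `i∞` with a polynomial of degree at most `k` in a given function with a simple pole. -/
theorem exists_polynomial_tendsto {w : ℂ → ℂ} {c : ℂ} (hc : c ≠ 0)
    (hw : DifferentiableOn ℂ w {τ | 0 < τ.im}) (hw1 : ∀ τ : ℂ, 0 < τ.im → w (τ + 1) = w τ)
    (hwc : Tendsto (fun τ ↦ cexp (2 * Real.pi * I * τ) * w τ) (comap im atTop) (𝓝 c))
    (k : ℕ) {h : ℂ → ℂ} (hd : DifferentiableOn ℂ h {τ | 0 < τ.im})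
    (h1 : ∀ τ : ℂ, 0 < τ.im → h (τ + 1) = h τ)
    (hb : (fun τ ↦ cexp (2 * Real.pi * I * τ) ^ k * h τ) =O[comap im atTop] (1 : ℂ → ℂ)) :
    ∃ P : Polynomial ℂ, P.natDegree ≤ k ∧
      Tendsto (fun τ ↦ h τ - P.eval (w τ)) (comap im atTop) (𝓝 0) := by
  have hexp : ∀ τ : ℂ, cexp (2 * Real.pi * I * (τ + 1)) = cexp (2 * Real.pi * I * τ) := by
    intro τ
    rw [mul_add, Complex.exp_add, mul_one, Complex.exp_two_pi_mul_I, mul_one]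
  induction k generalizing h with
  | zero =>
    obtain ⟨L, hL⟩ := exists_isBigO_sub_of_periodic hd h1 (by simpa using hb)
    exact ⟨Polynomial.C L, by simp, by simpa using hL.trans_tendsto tendsto_cexp_two_pi_I_mul⟩
  | succ k ih =>
    have hG : DifferentiableOn ℂ (fun τ ↦ cexp (2 * Real.pi * I * τ) ^ (k + 1) * h τ)
        {τ | 0 < τ.im} := DifferentiableOn.mul (by fun_prop) hd
    obtain ⟨L, hL⟩ := exists_isBigO_sub_of_periodic hG
      (fun τ hτ ↦ by rw [hexp, h1 τ hτ]) hb
    -- The multiple of w^(k+1) is chosen to cancel the leading pole term. The normalised difference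
    -- tends to 0, and by periodicity it is then O(exp(2πiτ)), so the pole order drops by one.
    set h' : ℂ → ℂ := fun τ ↦ h τ - L / c ^ (k + 1) * w τ ^ (k + 1) with hh'
    have hd' : DifferentiableOn ℂ h' {τ | 0 < τ.im} := hd.sub ((hw.pow _).const_mul _)
    have h1' : ∀ τ : ℂ, 0 < τ.im → h' (τ + 1) = h' τ := fun τ hτ ↦ by
      simp only [hh', h1 τ hτ, hw1 τ hτ]
    have hlim : Tendsto (fun τ ↦ cexp (2 * Real.pi * I * τ) ^ (k + 1) * h' τ)
        (comap im atTop) (𝓝 0) := by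
      have := (hL.trans_tendsto tendsto_cexp_two_pi_I_mul).add
        (((hwc.pow (k + 1)).const_mul (L / c ^ (k + 1))).const_sub L)
      rw [div_mul_cancel₀ _ (pow_ne_zero _ hc), sub_self, add_zero] at this
      refine this.congr fun τ ↦ ?_
      simp only [hh', mul_pow]
      ring
    obtain ⟨L', hL'⟩ := exists_isBigO_sub_of_periodic
      (h := fun τ ↦ cexp (2 * Real.pi * I * τ) ^ (k + 1) * h' τ)
      (DifferentiableOn.mul (by fun_prop) hd') (fun τ hτ ↦ by rw [hexp, h1' τ hτ])
      (hlim.isBigO_one ℂ)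
    have : NeBot (comap im atTop) := tendsto_mul_I_comap_im.neBot
    have hL0 : L' = 0 := by
      have h3 := hlim.sub (hL'.trans_tendsto tendsto_cexp_two_pi_I_mul)
      simp only [sub_sub_cancel, sub_zero] at h3
      exact tendsto_nhds_unique tendsto_const_nhds h3
    rw [hL0] at hL'
    obtain ⟨P, hP, hPt⟩ := ih hd' h1' (by
      have := hL'.mul (isBigO_refl (fun τ : ℂ ↦ (cexp (2 * Real.pi * I * τ))⁻¹) (comap im atTop))
      refine this.congr (fun τ ↦ ?_) (fun τ ↦ ?_)
      · have := Complex.exp_ne_zero (2 * Real.pi * I * τ)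
        rw [sub_zero, pow_succ]
        field_simp
      · simp [Complex.exp_ne_zero])
    refine ⟨P + Polynomial.C (L / c ^ (k + 1)) * Polynomial.X ^ (k + 1), ?_, ?_⟩
    · exact (Polynomial.natDegree_add_le _ _).trans
        (max_le (hP.trans k.le_succ) (Polynomial.natDegree_C_mul_X_pow_le _ _))
    · refine hPt.congr fun τ ↦ ?_
      simp only [hh', Polynomial.eval_add, Polynomial.eval_mul, Polynomial.eval_C,
        Polynomial.eval_pow, Polynomial.eval_X]
      ring

/-- The modular function `θ₂⁴ θ₄⁴ / (16 θ₃⁸)`. -/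
noncomputable def haupt (τ : ℂ) : ℂ :=
  theta2 τ ^ 4 * theta4 τ ^ 4 / (16 * jacobiTheta τ ^ 8)

/-- The expansion of `haupt` at the cusp `1`. -/
noncomputable def hauptShadow (τ : ℂ) : ℂ :=
  -(theta4 τ ^ 4 * jacobiTheta τ ^ 4) / (16 * theta2 τ ^ 8)

theorem haupt_add_one {τ : ℂ} :
    haupt (τ + 1) = -(theta2 τ ^ 4 * jacobiTheta τ ^ 4) / (16 * theta4 τ ^ 8) := by
  rw [haupt, theta2_add_one, theta4_add_one, ← theta4, mul_pow, exp_pi_mul_I_div_four_pow_four]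
  ring

theorem haupt_add_two (τ : ℂ) : haupt (τ + 2) = haupt τ := by
  rw [← one_add_one_eq_two, ← add_assoc, haupt_add_one, theta2_add_one, theta4_add_one, mul_pow,
    exp_pi_mul_I_div_four_pow_four, haupt, ← theta4]
  ring

theorem haupt_neg_one_div {τ : ℂ} (hτ : 0 < τ.im) : haupt (-1 / τ) = haupt τ := by
  have h0 := ne_zero_of_im_pos hτ
  have h1 := sqrt_factor_ne_zero hτ
  rw [haupt, haupt, theta2_neg_one_div hτ, theta4_neg_one_div hτ, jacobiTheta_neg_one_div hτ]
  have := jacobiTheta_ne_zero hτ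
  field_simp

theorem haupt_one_sub_one_div {τ : ℂ} (hτ : 0 < τ.im) : haupt (1 - 1 / τ) = hauptShadow τ := by
  have h0 := ne_zero_of_im_pos hτ
  have h1 := sqrt_factor_ne_zero hτ
  have h2 := theta2_ne_zero hτ
  rw [show 1 - 1 / τ = -1 / τ + 1 by ring, haupt_add_one, theta2_neg_one_div hτ,
    theta4_neg_one_div hτ, jacobiTheta_neg_one_div hτ, hauptShadow]
  field_simp

theorem differentiableOn_haupt : DifferentiableOn ℂ haupt {τ | 0 < τ.im} :=
  ((differentiableOn_theta2.pow 4).mul (differentiableOn_theta4.pow 4)).div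
    ((differentiableOn_jacobiTheta.pow 8).const_mul 16) fun τ hτ ↦
      mul_ne_zero (by norm_num) (pow_ne_zero _ (jacobiTheta_ne_zero hτ))

theorem tendsto_haupt : Tendsto haupt (comap im atTop) (𝓝 0) := by
  have := (tendsto_cexp_pi_I_mul.mul (((tendsto_theta2.pow 4).mul (tendsto_theta4.pow 4)).div
    ((tendsto_jacobiTheta.pow 8).const_mul 16) (by norm_num)))
  rw [zero_mul] at this
  refine this.congr fun τ ↦ ?_
  have h : cexp (Real.pi * I * τ) * cexp (-(Real.pi * I * τ / 4)) ^ 4 = 1 := by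
    rw [← Complex.exp_nat_mul, ← Complex.exp_add,
      show Real.pi * I * τ + (4 : ℕ) * (-(Real.pi * I * τ / 4)) = 0 by push_cast; ring,
      Complex.exp_zero]
  rw [Pi.div_apply, haupt]
  linear_combination theta2 τ ^ 4 * theta4 τ ^ 4 / (16 * jacobiTheta τ ^ 8) * h

/-- From θ₂⁸ ~ 2⁸q² and 16 · 2⁸ = 4096: a simple pole in q² = exp(2πiτ), so pole orders at the cusp
1 become polynomial degrees. -/
theorem tendsto_hauptShadow :
    Tendsto (fun τ ↦ cexp (2 * Real.pi * I * τ) * hauptShadow τ) (comap im atTop)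
      (𝓝 (-1 / 4096)) := by
  have := ((tendsto_theta4.pow 4).mul (tendsto_jacobiTheta.pow 4)).neg.div
    ((tendsto_theta2.pow 8).const_mul 16) (by norm_num)
  norm_num at this
  rw [show -((1 : ℂ) / 4096) = -1 / 4096 by ring] at this
  refine this.congr fun τ ↦ ?_
  have h : cexp (2 * Real.pi * I * τ) * cexp (-(Real.pi * I * τ / 4)) ^ 8 = 1 := by
    rw [← Complex.exp_nat_mul, ← Complex.exp_add,
      show 2 * Real.pi * I * τ + (8 : ℕ) * (-(Real.pi * I * τ / 4)) = 0 by push_cast; ring,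
      Complex.exp_zero]
  have h0 := Complex.exp_ne_zero (-(Real.pi * I * τ / 4))
  rw [eq_inv_of_mul_eq_one_left h, Pi.div_apply, hauptShadow, mul_pow]
  field_simp

/-- Modular functions for the theta group with a pole of order at most `k` at the cusp `1` only
are polynomials of degree at most `k` in `haupt`. -/
theorem exists_polynomial_haupt {f : ℂ → ℂ} (hf : DifferentiableOn ℂ f {τ | 0 < τ.im})
    (h2 : ∀ τ : ℂ, 0 < τ.im → f (τ + 2) = f τ) (hS : ∀ τ : ℂ, 0 < τ.im → f (-1 / τ) = f τ)
    (hb : f =O[comap im atTop] (1 : ℂ → ℂ)) (k : ℕ)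
    (hk : (fun τ ↦ cexp (2 * Real.pi * I * τ) ^ k * f (1 - 1 / τ)) =O[comap im atTop]
      (1 : ℂ → ℂ)) :
    ∃ P : Polynomial ℂ, P.natDegree ≤ k ∧ ∀ τ : ℂ, 0 < τ.im → f τ = P.eval (haupt τ) := by
  have hlim : Tendsto (fun τ ↦ cexp (2 * Real.pi * I * τ) * haupt (1 - 1 / τ)) (comap im atTop)
      (𝓝 (-1 / 4096)) := by
    refine tendsto_hauptShadow.congr' ?_
    filter_upwards [eventually_im_pos] with τ hτ
    rw [haupt_one_sub_one_div hτ]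
  obtain ⟨P, hP, hPt⟩ := exists_polynomial_tendsto (by norm_num)
    (differentiableOn_comp_one_sub_one_div differentiableOn_haupt)
    (fun τ hτ ↦ comp_one_sub_one_div_add_one (fun τ _ ↦ haupt_add_two τ)
      (fun τ hτ ↦ haupt_neg_one_div hτ) hτ) hlim k
    (differentiableOn_comp_one_sub_one_div hf)
    (fun τ hτ ↦ comp_one_sub_one_div_add_one h2 hS hτ) hk
  refine ⟨P, hP, fun τ hτ ↦ sub_eq_zero.1 ?_⟩
  refine eq_zero_of_thetaGroup (g := fun τ ↦ f τ - P.eval (haupt τ))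
    (hf.sub (P.differentiable.comp_differentiableOn differentiableOn_haupt))
    (fun τ hτ ↦ by rw [h2 τ hτ, haupt_add_two]) (fun τ hτ ↦ by rw [hS τ hτ, haupt_neg_one_div hτ])
    (hb.sub ?_) hPt hτ
  exact ((P.continuous.tendsto 0).comp tendsto_haupt).isBigO_one ℂ

/-- The point i is fixed by τ ↦ −1/τ, which swaps θ₂ and θ₄; they agree there, and Jacobi's identity
applies. -/
theorem jacobiTheta_I_pow_four : jacobiTheta I ^ 4 = 2 * theta2 I ^ 4 := by
  have h := theta2_neg_one_div (τ := I) (by simp)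
  rw [show -1 / I = I by rw [div_I]; simp, show -I * I = 1 by simp, one_cpow, one_mul] at h
  rw [jacobiTheta_pow_four (by simp), ← h, two_mul]

theorem haupt_I : haupt I = 1 / 64 := by
  have h := theta2_neg_one_div (τ := I) (by simp)
  rw [show -1 / I = I by rw [div_I]; simp, show -I * I = 1 by simp, one_cpow, one_mul] at h
  have h2 := theta2_ne_zero (τ := I) (by simp)
  rw [haupt, show jacobiTheta I ^ 8 = (jacobiTheta I ^ 4) ^ 2 by ring, jacobiTheta_I_pow_four, ← h]
  field_simp
  norm_num

end BelfioreSole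

/-! ### Unimodular lattices: self-duality and characteristic vectors -/

namespace BelfioreSole

open Module MeasureTheory

section Lattice

variable {n : ℕ} {Λ : Submodule ℤ (EuclideanSpace ℝ (Fin n))} [DiscreteTopology Λ] [IsZLattice ℝ Λ]

theorem inner_eq_of_forall_basis (b : Basis (Fin n) ℤ Λ) {v w : EuclideanSpace ℝ (Fin n)}
    (h : ∀ i, ⟪v, (b i : EuclideanSpace ℝ (Fin n))⟫_ℝ = ⟪w, (b i : EuclideanSpace ℝ (Fin n))⟫_ℝ) :
    v = w := by
  refine InnerProductSpace.ext_inner_right_basis (𝕜 := ℝ) (b.ofZLatticeBasis ℝ Λ) fun i ↦ ?_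
  simpa using h i

theorem abs_det_toMatrix_eq_one (hcov : ZLattice.covolume Λ = 1) (b : Basis (Fin n) ℤ Λ) :
    |((EuclideanSpace.basisFun (Fin n) ℝ).toBasis.toMatrix
      fun i ↦ (b i : EuclideanSpace ℝ (Fin n))).det| = 1 := by
  have h := ZLattice.covolume_eq_det_mul_measureReal Λ (μ := volume) b
    (EuclideanSpace.basisFun (Fin n) ℝ).toBasis
  have h1 : volume.real (ZSpan.fundamentalDomain (EuclideanSpace.basisFun (Fin n) ℝ).toBasis)
      = 1 := by
    rw [measureReal_congr (ZSpan.fundamentalDomain_ae_parallelepiped _ volume), Measure.real]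
    have := (EuclideanSpace.basisFun (Fin n) ℝ).volume_parallelepiped
    simp at this ⊢
    rw [this]
    simp
  rw [h1, mul_one, hcov] at h
  rw [h, Basis.det_apply]
  rfl

/-- The integral Gram matrix is MᵀM with |det M| = 1, so its adjugate is an integral inverse and
solves for the coordinates of w. -/
theorem exists_inner_basis_eq (hΛ : IsUnimodular Λ) (b : Basis (Fin n) ℤ Λ) (m : Fin n → ℤ) :
    ∃ w ∈ Λ, ∀ i, ⟪w, (b i : EuclideanSpace ℝ (Fin n))⟫_ℝ = m i := by
  choose G hG using fun i j ↦ hΛ.1 (b i) (b i).2 (b j) (b j).2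
  set M := (EuclideanSpace.basisFun (Fin n) ℝ).toBasis.toMatrix
    fun i ↦ (b i : EuclideanSpace ℝ (Fin n)) with hM
  have hgram : (Matrix.of G).map (Int.cast : ℤ → ℝ) = M.transpose * M := by
    ext i j
    simp only [Matrix.map_apply, Matrix.of_apply, ← hG, Matrix.mul_apply, Matrix.transpose_apply,
      hM, Basis.toMatrix_apply, PiLp.inner_apply]
    simp [mul_comm]
  have hdet : (Matrix.of G).det = 1 := by
    have h1 : (((Matrix.of G).det : ℤ) : ℝ) = 1 := by
      rw [Int.cast_det, hgram, Matrix.det_mul, Matrix.det_transpose, ← abs_mul_abs_self,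
        abs_det_toMatrix_eq_one hΛ.2 b, one_mul]
    exact_mod_cast h1
  set c := (Matrix.of G).adjugate.mulVec m with hc
  have hGc : (Matrix.of G).mulVec c = m := by
    rw [hc, Matrix.mulVec_mulVec, Matrix.mul_adjugate, hdet, one_smul, Matrix.one_mulVec]
  refine ⟨∑ j, c j • (b j : EuclideanSpace ℝ (Fin n)),
    Λ.sum_mem fun j _ ↦ Λ.smul_mem _ (b j).2, fun i ↦ ?_⟩
  rw [sum_inner, ← hGc, Matrix.mulVec, dotProduct]
  push_cast
  refine Finset.sum_congr rfl fun j _ ↦ ?_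
  rw [Matrix.of_apply, ← hG i j, ← Int.cast_smul_eq_zsmul ℝ, real_inner_smul_left,
    real_inner_comm, mul_comm]

/-- A unimodular lattice is its own dual. -/
theorem exists_equiv_inner_basis (hΛ : IsUnimodular Λ) (b : Basis (Fin n) ℤ Λ) :
    ∃ e : Λ ≃ (Fin n → ℤ), ∀ (w : Λ) (i : Fin n),
      ⟪(w : EuclideanSpace ℝ (Fin n)), (b i : EuclideanSpace ℝ (Fin n))⟫_ℝ = e w i := by
  choose f hf using fun (w : Λ) (i : Fin n) ↦ hΛ.1 w w.2 (b i) (b i).2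
  refine ⟨Equiv.ofBijective f ⟨fun v w hvw ↦ ?_, fun m ↦ ?_⟩, hf⟩
  · refine Subtype.ext (inner_eq_of_forall_basis b fun i ↦ ?_)
    rw [hf, hf, hvw]
  · obtain ⟨w, hw, h⟩ := exists_inner_basis_eq hΛ b m
    refine ⟨⟨w, hw⟩, funext fun i ↦ ?_⟩
    have := (hf ⟨w, hw⟩ i).symm.trans (h i)
    exact_mod_cast this

theorem nonempty_basis_fin : Nonempty (Basis (Fin n) ℤ Λ) := by
  have := ZLattice.module_finite ℝ Λ
  have := ZLattice.module_free ℝ Λ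
  exact ⟨Module.finBasisOfFinrankEq ℤ Λ (by rw [ZLattice.rank ℝ Λ]; simp)⟩

/-- Every unimodular lattice has a characteristic vector. -/
theorem exists_isCharacteristic (hΛ : IsUnimodular Λ) : ∃ w, IsCharacteristic Λ w := by
  obtain ⟨b⟩ := nonempty_basis_fin (Λ := Λ)
  choose m hm using fun i ↦ hΛ.1 (b i) (b i).2 (b i) (b i).2
  -- Modulo 2 the map v ↦ (v, v) is linear, since the cross term 2(x, y) is even and a² ≡ a;
  -- matching it on a basis suffices.
  obtain ⟨w, hw, h⟩ := exists_inner_basis_eq hΛ b m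
  refine ⟨w, hw, fun v hv ↦ ?_⟩
  have hspan : (⟨v, hv⟩ : Λ) ∈ Submodule.span ℤ (Set.range b) := by rw [b.span_eq]; trivial
  change ∃ m : ℤ, ⟪w, ((⟨v, hv⟩ : Λ) : EuclideanSpace ℝ (Fin n))⟫_ℝ -
    ⟪((⟨v, hv⟩ : Λ) : EuclideanSpace ℝ (Fin n)), ((⟨v, hv⟩ : Λ) : EuclideanSpace ℝ (Fin n))⟫_ℝ
      = 2 * m
  generalize (⟨v, hv⟩ : Λ) = u at hspan
  induction hspan using Submodule.span_induction with
  | mem x hx =>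
    obtain ⟨i, rfl⟩ := hx
    exact ⟨0, by rw [h, hm]; simp⟩
  | zero => exact ⟨0, by simp⟩
  | add x y _ _ hx hy =>
    obtain ⟨p, hp⟩ := hx
    obtain ⟨q, hq⟩ := hy
    obtain ⟨r, hr⟩ := hΛ.1 x x.2 y y.2
    refine ⟨p + q - r, ?_⟩
    push_cast
    rw [inner_add_right, inner_add_left, inner_add_right, inner_add_right,
      real_inner_comm (x : EuclideanSpace ℝ (Fin n)) y, ← hr]
    linear_combination hp + hq
  | smul a x _ hx =>
    obtain ⟨p, hp⟩ := hx
    obtain ⟨r, hr⟩ := hΛ.1 x x.2 x x.2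
    obtain ⟨k, hk⟩ := Int.even_mul_succ_self (a - 1)
    refine ⟨a * p - k * r, ?_⟩
    have hk' : (a : ℝ) ^ 2 - a = 2 * k := by
      have : a ^ 2 - a = 2 * k := by linear_combination hk
      exact_mod_cast this
    push_cast
    rw [← Int.cast_smul_eq_zsmul ℝ, real_inner_smul_right, real_inner_smul_left,
      real_inner_smul_right, ← hr]
    linear_combination a * hp - ⟪(x : EuclideanSpace ℝ (Fin n)), (x : EuclideanSpace ℝ (Fin n))⟫_ℝ *
      hk'

end Lattice

end BelfioreSole

/-! ### Gaussian sums over translates of a lattice -/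

namespace BelfioreSole

open Module MeasureTheory Complex Filter Topology

section Lattice

variable {n : ℕ} {Λ : Submodule ℤ (EuclideanSpace ℝ (Fin n))} [DiscreteTopology Λ]

theorem norm_cexp_neg_mul_sq (b : ℂ) (r : ℝ) :
    ‖cexp (-b * (r : ℂ) ^ 2)‖ = Real.exp (-b.re * r ^ 2) := by
  rw [Complex.norm_exp, ← ofReal_pow, re_mul_ofReal, neg_re]

/-- From ‖x‖² ≤ 2‖x + v‖² + 2‖v‖²: halving the rate gives a majorant uniform for v in a ball. -/
theorem norm_cexp_neg_mul_norm_add_sq_le {b : ℂ} (hb : 0 < b.re) {R : ℝ}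
    {v : EuclideanSpace ℝ (Fin n)} (hv : ‖v‖ ≤ R) (x : EuclideanSpace ℝ (Fin n)) :
    ‖cexp (-b * ‖x + v‖ ^ 2)‖ ≤ Real.exp (-(b.re / 2) * ‖x + 0‖ ^ 2) * Real.exp (b.re * R ^ 2) := by
  rw [norm_cexp_neg_mul_sq, ← Real.exp_add]
  apply Real.exp_le_exp.2
  have hv' : ‖v‖ ^ 2 ≤ R ^ 2 := by gcongr
  have h2 : ‖x‖ ^ 2 ≤ 2 * ‖x + v‖ ^ 2 + 2 * ‖v‖ ^ 2 := by
    have := norm_sub_le (x + v) v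
    rw [add_sub_cancel_right] at this
    nlinarith [sq_nonneg (‖x + v‖ - ‖v‖), norm_nonneg x]
  rw [add_zero]
  nlinarith

/-- Comparison exp(−t) ≤ k!/tᵏ with a convergent sum of ‖x + u‖^(−2k); at most one x, namely −u,
must be excluded. -/
theorem summable_exp_norm_add_sq (u : EuclideanSpace ℝ (Fin n)) {ε : ℝ} (hε : 0 < ε) :
    Summable fun x : Λ ↦ Real.exp (-ε * ‖(x : EuclideanSpace ℝ (Fin n)) + u‖ ^ 2) := by
  set k := finrank ℤ Λ + 1 with hk
  have hs := (ZLattice.summable_norm_sub_inv_pow Λ (2 * k) (by omega) (-u)).mul_left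
    (k.factorial / ε ^ k : ℝ)
  refine summable_of_isBigO hs (Asymptotics.IsBigO.of_bound 1 ?_)
  have hfin : {x : Λ | (x : EuclideanSpace ℝ (Fin n)) = -u}.Finite :=
    Set.Subsingleton.finite fun x hx y hy ↦ Subtype.ext (hx.trans hy.symm)
  filter_upwards [hfin.compl_mem_cofinite] with x hx
  have hpos : 0 < ‖(x : EuclideanSpace ℝ (Fin n)) + u‖ := by
    rw [norm_pos_iff]
    exact fun h ↦ hx (eq_neg_of_add_eq_zero_left h)
  rw [sub_neg_eq_add, Real.norm_of_nonneg (Real.exp_pos _).le, one_mul, Real.norm_of_nonneg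
    (by positivity)]
  have := Real.pow_div_factorial_le_exp _ (mul_pos hε (pow_pos hpos 2)).le k
  rw [neg_mul, Real.exp_neg]
  rw [inv_pow, inv_le_comm₀ (Real.exp_pos _) (by positivity)]
  refine le_trans (le_of_eq ?_) this
  rw [mul_pow, ← pow_mul]
  field_simp

theorem summable_cexp_norm_add_sq (u : EuclideanSpace ℝ (Fin n)) {b : ℂ} (hb : 0 < b.re) :
    Summable fun x : Λ ↦ cexp (-b * ‖(x : EuclideanSpace ℝ (Fin n)) + u‖ ^ 2) := by
  refine Summable.of_norm ((summable_exp_norm_add_sq (Λ := Λ) u hb).congr fun x ↦ ?_)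
  rw [norm_cexp_neg_mul_sq]

theorem continuous_tsum_cexp_norm_add_sq {b : ℂ} (hb : 0 < b.re) :
    Continuous fun v : EuclideanSpace ℝ (Fin n) ↦
      ∑' x : Λ, cexp (-b * ‖(x : EuclideanSpace ℝ (Fin n)) + v‖ ^ 2) := by
  rw [continuous_iff_continuousAt]
  intro v₀
  set R := ‖v₀‖ + 1
  have hs := (summable_exp_norm_add_sq (Λ := Λ) 0 (half_pos hb)).mul_right
    (Real.exp (b.re * R ^ 2))
  exact ContinuousOn.continuousAt (s := Metric.ball 0 R) (continuousOn_tsum (fun x ↦ by fun_prop)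
    hs fun x v hv ↦ norm_cexp_neg_mul_norm_add_sq_le hb (by simpa using (Metric.mem_ball.1 hv).le) _)
    (Metric.isOpen_ball.mem_nhds (by simp [R]))

variable [IsZLattice ℝ Λ]

theorem volume_eq_addHaar (hcov : ZLattice.covolume Λ = 1) (b : Basis (Fin n) ℤ Λ) :
    (b.ofZLatticeBasis ℝ Λ).addHaar = volume := by
  rw [Basis.addHaar_eq_iff, Basis.coe_parallelepiped,
    ← measure_congr (ZSpan.fundamentalDomain_ae_parallelepiped _ volume)]
  have h := ZLattice.covolume_eq_measure_fundamentalDomain Λ volume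
    (ZLattice.isAddFundamentalDomain b volume)
  rw [hcov, Measure.real, eq_comm, ENNReal.toReal_eq_one_iff] at h
  exact h

theorem measurePreserving_equivFun_symm (hcov : ZLattice.covolume Λ = 1)
    (b : Basis (Fin n) ℤ Λ) :
    MeasurePreserving (b.ofZLatticeBasis ℝ Λ).equivFun.symm.toContinuousLinearEquiv := by
  refine ⟨(ContinuousLinearEquiv.continuous _).measurable, ?_⟩
  have h : (Pi.basisFun ℝ (Fin n)).addHaar = volume := by
    rw [Basis.addHaar_def, Basis.parallelepiped_basisFun, addHaarMeasure_eq_volume_pi]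
  rw [← volume_eq_addHaar hcov b, ← h, Basis.map_addHaar]
  congr 1
  ext i : 1
  simp

/-- The Fourier transform at a dual vector of a Gaussian, as an integral over the fundamental
domain of the periodised Gaussian. -/
theorem setIntegral_fundamentalDomain_tsum (b : Basis (Fin n) ℤ Λ)
    {w : EuclideanSpace ℝ (Fin n)} (hw : ∀ x ∈ Λ, ∃ m : ℤ, ⟪w, x⟫_ℝ = m) {β : ℂ} (hβ : 0 < β.re) :
    ∫ v in ZSpan.fundamentalDomain (b.ofZLatticeBasis ℝ Λ), cexp (-(2 * Real.pi * I) * ⟪w, v⟫_ℝ) *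
      ∑' x : Λ, cexp (-β * ‖(x : EuclideanSpace ℝ (Fin n)) + v‖ ^ 2) =
    (Real.pi / β) ^ (n / 2 : ℂ) * cexp (-Real.pi ^ 2 / β * ‖w‖ ^ 2) := by
  have hint := GaussianFourier.integrable_cexp_neg_mul_sq_norm_add hβ (-(2 * Real.pi * I)) w
  have hD := ZLattice.isAddFundamentalDomain b (volume : Measure (EuclideanSpace ℝ (Fin n)))
  have : VAddInvariantMeasure Λ (EuclideanSpace ℝ (Fin n)) volume :=
    inferInstanceAs (VAddInvariantMeasure Λ.toAddSubgroup (EuclideanSpace ℝ (Fin n)) volume)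
  -- The character v ↦ exp(−2πi(w, v)) is Λ-periodic because (w, x) is an integer.
  have hper : ∀ (x : Λ) (v : EuclideanSpace ℝ (Fin n)),
      cexp (-β * ‖x +ᵥ v‖ ^ 2 + -(2 * Real.pi * I) * ⟪w, x +ᵥ v⟫_ℝ) =
      cexp (-(2 * Real.pi * I) * ⟪w, v⟫_ℝ) *
        cexp (-β * ‖(x : EuclideanSpace ℝ (Fin n)) + v‖ ^ 2) := by
    intro x v
    obtain ⟨m, hm⟩ := hw x x.2
    rw [← Complex.exp_add, Submodule.vadd_def, vadd_eq_add, inner_add_right, hm,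
      Complex.exp_eq_exp_iff_exists_int]
    refine ⟨-m, ?_⟩
    push_cast
    ring
  have hint' : ∀ x : Λ, IntegrableOn (fun v ↦ cexp (-(2 * Real.pi * I) * ⟪w, v⟫_ℝ) *
        cexp (-β * ‖(x : EuclideanSpace ℝ (Fin n)) + v‖ ^ 2))
        (ZSpan.fundamentalDomain (b.ofZLatticeBasis ℝ Λ)) := by
    intro x
    simp_rw [← hper x]
    exact (((measurePreserving_vadd x volume).integrable_comp_emb
      (measurableEmbedding_const_vadd x)).2 hint).integrableOn
  have hsum : Summable fun x : Λ ↦ ∫ v in ZSpan.fundamentalDomain (b.ofZLatticeBasis ℝ Λ),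
      ‖cexp (-(2 * Real.pi * I) * ⟪w, v⟫_ℝ) *
        cexp (-β * ‖(x : EuclideanSpace ℝ (Fin n)) + v‖ ^ 2)‖ := by
    obtain ⟨R, hR⟩ := (ZSpan.fundamentalDomain_isBounded (b.ofZLatticeBasis ℝ Λ)).exists_norm_le
    refine Summable.of_nonneg_of_le (fun x ↦ integral_nonneg fun v ↦ norm_nonneg _) (fun x ↦ ?_)
      (((summable_exp_norm_add_sq (Λ := Λ) 0 (half_pos hβ)).mul_right
        (Real.exp (β.re * R ^ 2))).mul_right
        (volume.real (ZSpan.fundamentalDomain (b.ofZLatticeBasis ℝ Λ))))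
    refine (Real.le_norm_self _).trans (norm_setIntegral_le_of_norm_le_const ?_ fun v hv ↦ ?_)
    · exact (ZSpan.fundamentalDomain_isBounded _).measure_lt_top
    · rw [norm_norm, norm_mul, Complex.norm_exp]
      have : (-(2 * Real.pi * I) * (⟪w, v⟫_ℝ : ℂ)).re = 0 := by simp
      rw [this, Real.exp_zero, one_mul]
      exact norm_cexp_neg_mul_norm_add_sq_le hβ (hR v hv) _
  have h1 := (hasSum_integral_of_summable_integral_norm hint' hsum).tsum_eq
  simp_rw [tsum_mul_left] at h1
  rw [← h1]
  simp_rw [← hper]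
  rw [← hD.integral_eq_tsum'' _ hint, GaussianFourier.integral_cexp_neg_mul_sq_norm_add hβ]
  simp only [finrank_euclideanSpace, Fintype.card_fin]
  congr 2
  rw [neg_sq, mul_pow, I_sq, mul_pow]
  ring

end Lattice

end BelfioreSole

/-! ### Poisson summation -/

namespace BelfioreSole

open Module MeasureTheory Complex Filter Topology

section Lattice

theorem mFourier_coe_apply {d : Type*} [Fintype d] (m : d → ℤ) (s : d → ℝ) :
    UnitAddTorus.mFourier m (fun i ↦ (s i : UnitAddCircle)) =
      cexp (2 * Real.pi * I * ∑ i, (m i : ℂ) * (s i : ℂ)) := by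
  rw [UnitAddTorus.mFourier, ContinuousMap.coe_mk, Finset.mul_sum, Complex.exp_sum]
  refine Finset.prod_congr rfl fun i _ ↦ ?_
  rw [fourier_coe_apply]
  congr 1
  push_cast
  ring

variable {n : ℕ} {Λ : Submodule ℤ (EuclideanSpace ℝ (Fin n))} [DiscreteTopology Λ] [IsZLattice ℝ Λ]

/-- The Poisson summation formula for Gaussians on a unimodular lattice. -/
theorem tsum_cexp_norm_add_sq (hΛ : IsUnimodular Λ) (u : EuclideanSpace ℝ (Fin n)) {β : ℂ}
    (hβ : 0 < β.re) :
    ∑' x : Λ, cexp (-β * ‖(x : EuclideanSpace ℝ (Fin n)) + u‖ ^ 2) =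
      (Real.pi / β) ^ (n / 2 : ℂ) *
        ∑' w : Λ, cexp (-Real.pi ^ 2 / β * ‖(w : EuclideanSpace ℝ (Fin n))‖ ^ 2) *
          cexp (2 * Real.pi * I * ⟪(w : EuclideanSpace ℝ (Fin n)), u⟫_ℝ) := by
  obtain ⟨b⟩ := nonempty_basis_fin (Λ := Λ)
  obtain ⟨e, he⟩ := exists_equiv_inner_basis hΛ b
  set B := b.ofZLatticeBasis ℝ Λ with hB
  set T := B.equivFun.symm.toContinuousLinearEquiv with hT
  have hTs : ∀ s : Fin n → ℝ, T s = ∑ i, s i • (b i : EuclideanSpace ℝ (Fin n)) := by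
    intro s
    simp [hT, hB, Basis.equivFun_symm_apply]
  set F : EuclideanSpace ℝ (Fin n) → ℂ := fun v ↦
    ∑' x : Λ, cexp (-β * ‖(x : EuclideanSpace ℝ (Fin n)) + v‖ ^ 2) with hF
  have hFc : Continuous F := continuous_tsum_cexp_norm_add_sq hβ
  have hFper : ∀ (x : Λ) v, F (x + v) = F v := by
    intro x v
    rw [hF]
    simp only
    rw [← (Equiv.addRight x).tsum_eq fun y : Λ ↦
      cexp (-β * ‖(y : EuclideanSpace ℝ (Fin n)) + v‖ ^ 2)]
    simp [add_assoc]
  set p : (Fin n → ℝ) → UnitAddTorus (Fin n) := fun s i ↦ (s i : UnitAddCircle) with hp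
  have hpq : IsOpenQuotientMap p :=
    IsOpenQuotientMap.piMap fun _ ↦ QuotientAddGroup.isOpenQuotientMap_mk
  have hlift : ∀ s s', p s = p s' → F (T s) = F (T s') := by
    intro s s' hss
    have h1 : ∀ i, ∃ k : ℤ, s i = k + s' i := by
      intro i
      have : ((s i - s' i : ℝ) : UnitAddCircle) = 0 := by
        rw [AddCircle.coe_sub, sub_eq_zero]
        exact congrFun hss i
      obtain ⟨k, hk⟩ := (AddCircle.coe_eq_zero_iff _).1 this
      refine ⟨k, ?_⟩
      rw [zsmul_eq_mul, mul_one] at hk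
      linarith
    choose k hk using h1
    have h2 : T s = ((∑ i, k i • b i : Λ) : EuclideanSpace ℝ (Fin n)) + T s' := by
      rw [hTs, hTs]
      simp only [Submodule.coe_sum, Submodule.coe_smul, ← Finset.sum_add_distrib]
      refine Finset.sum_congr rfl fun i _ ↦ ?_
      rw [hk i, add_smul, Int.cast_smul_eq_zsmul]
    rw [h2, hFper]
  -- In lattice coordinates the periodised Gaussian descends to the standard torus; self-duality
  -- identifies its Fourier modes with vectors of Λ.
  set f : C(UnitAddTorus (Fin n), ℂ) :=
    { toFun := fun t ↦ F (T (Function.surjInv hpq.surjective t))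
      continuous_toFun := by
        refine hpq.isQuotientMap.continuous_iff.2 ?_
        refine (hFc.comp T.continuous).congr fun s ↦ ?_
        exact (hlift _ _ (Function.surjInv_eq hpq.surjective (p s))).symm } with hf
  have hfp : ∀ s, f (p s) = F (T s) := fun s ↦
    hlift _ _ (Function.surjInv_eq hpq.surjective (p s))
  have hpair : ∀ (w : Λ) (s : Fin n → ℝ),
      ((⟪(w : EuclideanSpace ℝ (Fin n)), T s⟫_ℝ : ℝ) : ℂ) = ∑ i, (e w i : ℂ) * s i := by
    intro w s
    rw [hTs, inner_sum]
    push_cast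
    refine Finset.sum_congr rfl fun i _ ↦ ?_
    rw [real_inner_smul_right, he]
    push_cast
    ring
  have hcoef : ∀ w : Λ, UnitAddTorus.mFourierCoeff f (e w) =
      (Real.pi / β) ^ (n / 2 : ℂ) *
        cexp (-Real.pi ^ 2 / β * ‖(w : EuclideanSpace ℝ (Fin n))‖ ^ 2) := by
    intro w
    rw [← setIntegral_fundamentalDomain_tsum b (fun x hx ↦ hΛ.1 w w.2 x hx) hβ,
      UnitAddTorus.mFourierCoeff_eq_integral _ _ 0]
    have h1 := (measurePreserving_equivFun_symm hΛ.2 b).setIntegral_preimage_emb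
      T.toHomeomorph.measurableEmbedding
      (fun v ↦ cexp (-(2 * Real.pi * I) * ⟪(w : EuclideanSpace ℝ (Fin n)), v⟫_ℝ) * F v)
      (ZSpan.fundamentalDomain B)
    rw [← h1]
    have h2 : T ⁻¹' ZSpan.fundamentalDomain B = Set.univ.pi fun _ ↦ Set.Ico (0 : ℝ) 1 := by
      ext s
      have h3 : ∀ i, B.repr (T s) i = s i := fun i ↦ by
        rw [← B.equivFun_apply]
        exact congrFun (B.equivFun.apply_symm_apply s) i
      simp only [Set.mem_preimage, ZSpan.mem_fundamentalDomain, h3, Set.mem_pi, Set.mem_univ,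
        true_imp_iff]
    have h3 : {s : Fin n → ℝ | ∀ i, s i ∈ Set.Ioc ((0 : Fin n → ℝ) i) ((0 : Fin n → ℝ) i + 1)} =
        Set.univ.pi fun _ ↦ Set.Ioc (0 : ℝ) 1 := by
      ext s
      simp [Set.mem_pi]
    -- Torus integrals use half-open boxes closed on the right, the fundamental domain boxes closed
    -- on the left; they differ by a null set.
    have h4 : (Set.univ.pi fun _ : Fin n ↦ Set.Ioc (0 : ℝ) 1) =ᵐ[volume]
        (Set.univ.pi fun _ : Fin n ↦ Set.Ico (0 : ℝ) 1) :=
      Measure.univ_pi_Ioc_ae_eq_Icc.trans Measure.univ_pi_Ico_ae_eq_Icc.symm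
    rw [h3, setIntegral_congr_set h4]
    change _ = ∫ s in T ⁻¹' ZSpan.fundamentalDomain B, _
    rw [h2]
    refine integral_congr_ae (Eventually.of_forall fun s ↦ ?_)
    simp only
    rw [mFourier_coe_apply, smul_eq_mul]
    change _ * f (p s) = _ * F (T s)
    rw [hfp]
    congr 2
    change _ = -(2 * Real.pi * I) * ((⟪(w : EuclideanSpace ℝ (Fin n)), T s⟫_ℝ : ℝ) : ℂ)
    rw [hpair, neg_mul, ← mul_neg, ← Finset.sum_neg_distrib]
    congr 1
    refine Finset.sum_congr rfl fun i _ ↦ ?_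
    rw [Pi.neg_apply]
    push_cast
    ring
  have hre : 0 < (Real.pi ^ 2 / β).re := by
    rw [← ofReal_pow, div_re]
    simp only [ofReal_re, ofReal_im, zero_mul, zero_div, add_zero]
    have : β ≠ 0 := by rintro rfl; simp at hβ
    have := normSq_pos.2 this
    have := Real.pi_pos
    positivity
  have hsum : Summable (UnitAddTorus.mFourierCoeff f) := by
    rw [← e.summable_iff]
    refine ((summable_cexp_norm_add_sq (Λ := Λ) 0 hre).mul_left
      ((Real.pi / β : ℂ) ^ (n / 2 : ℂ))).congr fun w ↦ ?_
    rw [Function.comp_apply, hcoef, add_zero, neg_div]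
  obtain ⟨s, rfl⟩ := T.surjective u
  have := UnitAddTorus.hasSum_mFourier_series_apply_of_summable hsum (p s)
  rw [hfp, ← e.hasSum_iff] at this
  change F (T s) = _
  rw [← this.tsum_eq, ← tsum_mul_left]
  refine tsum_congr fun w ↦ ?_
  rw [Function.comp_apply, hcoef, mFourier_coe_apply, hpair, smul_eq_mul, mul_assoc]

end Lattice

end BelfioreSole

/-! ### Theta functions of lattices and of their shadows -/

namespace BelfioreSole

open Module Complex Filter Topology Asymptotics

theorem summable_norm_prod_and_tsum_prod {ι : Type*} {f : ι → ℂ} (hf : Summable fun k ↦ ‖f k‖)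
    (n : ℕ) : (Summable fun k : Fin n → ι ↦ ‖∏ i, f (k i)‖) ∧
      ∑' k : Fin n → ι, ∏ i, f (k i) = (∑' k, f k) ^ n := by
  induction n with
  | zero => exact ⟨.of_finite, by simp⟩
  | succ n ih =>
    let e : ι × (Fin n → ι) ≃ (Fin (n + 1) → ι) := Fin.consEquiv fun _ ↦ ι
    have h (p : ι × (Fin n → ι)) :
        ∏ i : Fin (n + 1), f (e p i) = f p.1 * ∏ i : Fin n, f (p.2 i) := by
      rw [Fin.prod_univ_succ]
      rfl
    constructor
    · rw [← e.summable_iff]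
      have := hf.mul_norm (g := fun k : Fin n → ι ↦ ∏ i, f (k i)) ih.1
      refine this.congr fun p ↦ ?_
      rw [Function.comp_apply, h]
    · rw [← e.tsum_eq, tsum_congr h, pow_succ', ← ih.2,
        tsum_mul_tsum_of_summable_norm (g := fun k : Fin n → ι ↦ ∏ i, f (k i)) hf ih.1]

/-- The theta function of a translate of a lattice. -/
noncomputable def translateTheta {n : ℕ} (Λ : Submodule ℤ (EuclideanSpace ℝ (Fin n)))
    (u : EuclideanSpace ℝ (Fin n)) (τ : ℂ) : ℂ :=
  ∑' x : Λ, cexp (Real.pi * I * τ * (‖(x : EuclideanSpace ℝ (Fin n)) + u‖ ^ 2 : ℝ))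

section Lattice

variable {n : ℕ} {Λ : Submodule ℤ (EuclideanSpace ℝ (Fin n))}

theorem ofReal_theta (y : ℝ) : (theta Λ y : ℂ) = translateTheta Λ 0 (y * I) := by
  rw [theta, translateTheta, ofReal_tsum]
  refine tsum_congr fun x ↦ ?_
  rw [ofReal_exp, add_zero]
  congr 1
  push_cast
  linear_combination (-Real.pi * ‖(x : EuclideanSpace ℝ (Fin n))‖ ^ 2 * y : ℂ) * I_sq

theorem mem_intLattice_iff {x : EuclideanSpace ℝ (Fin n)} :
    x ∈ intLattice n ↔ ∀ i, ∃ k : ℤ, x i = k := by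
  have h : intLattice n =
      Submodule.span ℤ (Set.range (EuclideanSpace.basisFun (Fin n) ℝ).toBasis) := by
    rw [intLattice]
    congr 2
    ext i : 1
    simp
  rw [h, Basis.mem_span_iff_repr_mem]
  simp [eq_comm]

/-- The theta function of `ℤⁿ` is a power of the Jacobi theta function. -/
theorem translateTheta_intLattice {τ : ℂ} (hτ : 0 < τ.im) :
    translateTheta (intLattice n) 0 τ = jacobiTheta τ ^ n := by
  have hmem : ∀ k : Fin n → ℤ, WithLp.toLp 2 (fun i ↦ (k i : ℝ)) ∈ intLattice n := fun k ↦
    mem_intLattice_iff.2 fun i ↦ ⟨k i, rfl⟩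
  let e : (Fin n → ℤ) ≃ intLattice n := Equiv.ofBijective (fun k ↦ ⟨_, hmem k⟩) <| by
    constructor
    · intro k k' h
      have h1 := congrArg (fun x : intLattice n ↦ (x : EuclideanSpace ℝ (Fin n))) h
      funext i
      have := congrArg (fun x : EuclideanSpace ℝ (Fin n) ↦ x i) h1
      change ((k i : ℤ) : ℝ) = k' i at this
      exact_mod_cast this
    · rintro ⟨x, hx⟩
      choose k hk using mem_intLattice_iff.1 hx
      refine ⟨k, Subtype.ext ?_⟩
      ext i
      exact (hk i).symm
  have hs : Summable fun k : ℤ ↦ ‖cexp (Real.pi * I * τ * ((k ^ 2 : ℤ) : ℝ))‖ := by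
    refine (summable_exp_of_le_abs abs_sub_one_le_sq hτ).congr fun k ↦ ?_
    rw [norm_cexp_pi_mul]
  rw [jacobiTheta_eq_tsum, ← (summable_norm_prod_and_tsum_prod hs n).2, translateTheta,
    ← e.tsum_eq]
  refine tsum_congr fun k ↦ ?_
  rw [← Complex.exp_sum]
  congr 1
  have : ‖((e k : intLattice n) : EuclideanSpace ℝ (Fin n)) + 0‖ ^ 2 =
      ∑ i, (k i : ℝ) ^ 2 := by
    rw [add_zero, EuclideanSpace.real_norm_sq_eq]
    rfl
  rw [this]
  push_cast
  rw [Finset.mul_sum]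

variable [DiscreteTopology Λ]

theorem summable_exp_pi_mul (u : EuclideanSpace ℝ (Fin n)) {ε : ℝ} (hε : 0 < ε) :
    Summable fun x : Λ ↦
      Real.exp (-Real.pi * ε * ‖(x : EuclideanSpace ℝ (Fin n)) + u‖ ^ 2) := by
  simpa only [neg_mul] using summable_exp_norm_add_sq (Λ := Λ) u (mul_pos Real.pi_pos hε)

theorem differentiableOn_translateTheta (u : EuclideanSpace ℝ (Fin n)) :
    DifferentiableOn ℂ (translateTheta Λ u) {τ | 0 < τ.im} :=
  differentiableOn_tsum_cexp (fun _ ↦ sq_nonneg _) fun _ hε ↦ summable_exp_pi_mul u hε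

theorem isBigO_translateTheta (u : EuclideanSpace ℝ (Fin n)) {c : ℝ}
    (hc : ∀ x ∈ Λ, c ≤ ‖x + u‖ ^ 2) :
    translateTheta Λ u =O[comap im atTop] fun τ ↦ Real.exp (-Real.pi * c * τ.im) :=
  isBigO_tsum_cexp (fun x ↦ hc x x.2) fun _ hε ↦ summable_exp_pi_mul u hε

variable [IsZLattice ℝ Λ]

theorem sqrt_factor_pow (τ : ℂ) :
    (-I * τ) ^ (n / 2 : ℂ) = ((-I * τ) ^ (1 / 2 : ℂ)) ^ n := by
  rw [← cpow_nat_mul]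
  congr 1
  ring

theorem translateTheta_add_two (hΛ : IsUnimodular Λ) (τ : ℂ) :
    translateTheta Λ 0 (τ + 2) = translateTheta Λ 0 τ := by
  refine tsum_congr fun x ↦ ?_
  obtain ⟨m, hm⟩ := hΛ.1 x x.2 x x.2
  rw [add_zero, ← real_inner_self_eq_norm_sq, hm, Complex.exp_eq_exp_iff_exists_int]
  refine ⟨m, ?_⟩
  push_cast
  ring

theorem translateTheta_neg_one_div (hΛ : IsUnimodular Λ) {τ : ℂ} (hτ : 0 < τ.im) :
    translateTheta Λ 0 (-1 / τ) =
      ((-I * τ) ^ (1 / 2 : ℂ)) ^ n * translateTheta Λ 0 τ := by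
  have h0 := ne_zero_of_im_pos hτ
  have hre : 0 < (Real.pi * (-I * (-1 / τ))).re := by
    have := im_neg_one_div_pos hτ
    rw [re_ofReal_mul]
    have h1 : (-I * (-1 / τ)).re = (-1 / τ).im := by simp
    rw [h1]
    exact mul_pos Real.pi_pos this
  have h := tsum_cexp_norm_add_sq hΛ 0 hre
  have hpi : (Real.pi : ℂ) ≠ 0 := ofReal_ne_zero.2 Real.pi_ne_zero
  have h2 : (Real.pi : ℂ) / (Real.pi * (-I * (-1 / τ))) = -I * τ := by
    have := I_ne_zero
    field_simp
    linear_combination I_sq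
  have h3 : -(Real.pi : ℂ) ^ 2 / (Real.pi * (-I * (-1 / τ))) = Real.pi * I * τ := by
    have := I_ne_zero
    field_simp
    linear_combination -I_sq
  rw [h2, h3, sqrt_factor_pow] at h
  convert h using 1
  · refine tsum_congr fun x ↦ ?_
    congr 1
    push_cast
    ring
  · congr 1
    refine tsum_congr fun x ↦ ?_
    simp

/-- The theta function of the shadow of a unimodular lattice. -/
theorem translateTheta_one_sub_one_div (hΛ : IsUnimodular Λ) {w : EuclideanSpace ℝ (Fin n)}
    (hw : IsCharacteristic Λ w) {τ : ℂ} (hτ : 0 < τ.im) :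
    translateTheta Λ 0 (1 - 1 / τ) =
      ((-I * τ) ^ (1 / 2 : ℂ)) ^ n * translateTheta Λ ((1 / 2 : ℝ) • w) τ := by
  have h0 := ne_zero_of_im_pos hτ
  have hre : 0 < (Real.pi * (-I * τ)).re := by
    rw [re_ofReal_mul]
    have h1 : (-I * τ).re = τ.im := by simp
    rw [h1]
    exact mul_pos Real.pi_pos hτ
  have h := tsum_cexp_norm_add_sq hΛ ((1 / 2 : ℝ) • w) hre
  have hpi : (Real.pi : ℂ) ≠ 0 := ofReal_ne_zero.2 Real.pi_ne_zero
  have h2 : (Real.pi : ℂ) / (Real.pi * (-I * τ)) = (-I * τ)⁻¹ := by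
    have := I_ne_zero
    field_simp
  have h3 : -(Real.pi : ℂ) ^ 2 / (Real.pi * (-I * τ)) = Real.pi * I * (-1 / τ) := by
    have := I_ne_zero
    field_simp
    linear_combination I_sq
  have harg : (-I * τ).arg ≠ Real.pi := by
    have : 0 < (-I * τ).re := by simpa using hτ
    intro h
    have h5 := abs_arg_lt_pi_div_two_iff.2 (Or.inl this)
    rw [h, abs_of_pos Real.pi_pos] at h5
    linarith [Real.pi_pos]
  rw [h2, h3, inv_cpow _ _ harg, sqrt_factor_pow] at h
  have h4 : translateTheta Λ ((1 / 2 : ℝ) • w) τ =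
      (((-I * τ) ^ (1 / 2 : ℂ)) ^ n)⁻¹ * translateTheta Λ 0 (1 - 1 / τ) := by
    convert h using 1
    · refine tsum_congr fun x ↦ ?_
      congr 1
      push_cast
      ring
    · congr 1
      refine tsum_congr fun x ↦ ?_
      -- The Poisson phase exp(πi(w, x)) equals exp(πi(x, x)) as w is characteristic; this shifts
      -- −1/τ to 1 − 1/τ.
      obtain ⟨m, hm⟩ := hw.2 x x.2
      rw [← Complex.exp_add, add_zero, Complex.exp_eq_exp_iff_exists_int]
      refine ⟨-m, ?_⟩
      rw [real_inner_smul_right, real_inner_comm, ← real_inner_self_eq_norm_sq]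
      have hm' : (⟪w, (x : EuclideanSpace ℝ (Fin n))⟫_ℝ : ℂ) =
          ⟪(x : EuclideanSpace ℝ (Fin n)), (x : EuclideanSpace ℝ (Fin n))⟫_ℝ + 2 * m := by
        have : ⟪w, (x : EuclideanSpace ℝ (Fin n))⟫_ℝ =
          ⟪(x : EuclideanSpace ℝ (Fin n)), (x : EuclideanSpace ℝ (Fin n))⟫_ℝ + 2 * m := by
          linarith
        exact_mod_cast this
      push_cast
      have h7 : (‖(x : EuclideanSpace ℝ (Fin n))‖ : ℂ) ^ 2 =
          (⟪(x : EuclideanSpace ℝ (Fin n)), (x : EuclideanSpace ℝ (Fin n))⟫_ℝ : ℂ) := by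
        rw [real_inner_self_eq_norm_sq]; push_cast; rfl
      rw [hm', h7]
      ring
  rw [h4, mul_inv_cancel_left₀ (pow_ne_zero _ (sqrt_factor_ne_zero hτ))]

theorem isCharacteristic_add_two_smul (hΛ : IsUnimodular Λ) {w x : EuclideanSpace ℝ (Fin n)}
    (hw : IsCharacteristic Λ w) (hx : x ∈ Λ) : IsCharacteristic Λ (w + (2 : ℤ) • x) := by
  refine ⟨Λ.add_mem hw.1 (Λ.smul_mem _ hx), fun v hv ↦ ?_⟩
  obtain ⟨m, hm⟩ := hw.2 v hv
  obtain ⟨k, hk⟩ := hΛ.1 x hx v hv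
  refine ⟨m + k, ?_⟩
  rw [inner_add_left, ← Int.cast_smul_eq_zsmul ℝ, real_inner_smul_left, hk]
  push_cast
  linarith

/-- Twice x + w/2 is w + 2x, again a characteristic vector. -/
theorem div_four_le_norm_sq_shadow (hΛ : IsUnimodular Λ) {c : ℝ}
    (hc : ∀ v, IsCharacteristic Λ v → c ≤ ⟪v, v⟫_ℝ) {w x : EuclideanSpace ℝ (Fin n)}
    (hw : IsCharacteristic Λ w) (hx : x ∈ Λ) : c / 4 ≤ ‖x + (1 / 2 : ℝ) • w‖ ^ 2 := by
  have h := hc _ (isCharacteristic_add_two_smul hΛ hw hx)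
  have h2 : w + (2 : ℤ) • x = (2 : ℝ) • (x + (1 / 2 : ℝ) • w) := by
    rw [← Int.cast_smul_eq_zsmul ℝ, smul_add, smul_smul]
    norm_num
    rw [add_comm]
  rw [h2, real_inner_self_eq_norm_sq, norm_smul] at h
  norm_num [mul_pow] at h
  linarith

/-- Theta functions of `n - 8k` lattices are expressed by polynomials of degree at most `k`. -/
theorem exists_polynomial_translateTheta {k : ℕ} (hΛ : IsNSubEightKLattice k Λ)
    {w : EuclideanSpace ℝ (Fin n)} (hw : IsCharacteristic Λ w) :
    ∃ P : Polynomial ℂ, P.natDegree ≤ k ∧ ∀ τ : ℂ, 0 < τ.im →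
      translateTheta Λ 0 τ = jacobiTheta τ ^ n * P.eval (haupt τ) ∧
      translateTheta Λ ((1 / 2 : ℝ) • w) τ = theta2 τ ^ n * P.eval (hauptShadow τ) := by
  have hcusp : ∀ τ : ℂ, 0 < τ.im →
      translateTheta Λ 0 (1 - 1 / τ) / jacobiTheta (1 - 1 / τ) ^ n =
        translateTheta Λ ((1 / 2 : ℝ) • w) τ / theta2 τ ^ n := by
    intro τ hτ
    have h2 : jacobiTheta (1 - 1 / τ) = (-I * τ) ^ (1 / 2 : ℂ) * theta2 τ := by
      rw [← theta4_neg_one_div hτ, theta4]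
      congr 1
      ring
    rw [translateTheta_one_sub_one_div hΛ.1 hw hτ, h2, mul_pow,
      mul_div_mul_left _ _ (pow_ne_zero _ (sqrt_factor_ne_zero hτ))]
  have h1 : (fun _ : ℂ ↦ Real.exp 0) =O[comap im atTop] (1 : ℂ → ℂ) :=
    isBigO_of_le _ fun τ ↦ by simp
  obtain ⟨P, hP, h⟩ := exists_polynomial_haupt (k := k)
    (f := fun τ ↦ translateTheta Λ 0 τ / jacobiTheta τ ^ n)
    ((differentiableOn_translateTheta 0).div (differentiableOn_jacobiTheta.pow n)
      fun τ hτ ↦ pow_ne_zero _ (jacobiTheta_ne_zero hτ))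
    (fun τ _ ↦ by rw [translateTheta_add_two hΛ.1, add_comm, jacobiTheta_two_add])
    (fun τ hτ ↦ by
      rw [translateTheta_neg_one_div hΛ.1 hτ, jacobiTheta_neg_one_div hτ, mul_pow,
        mul_div_mul_left _ _ (pow_ne_zero _ (sqrt_factor_ne_zero hτ))])
    (by
      have h2 := isBigO_translateTheta (Λ := Λ) 0 (c := 0) fun x _ ↦ sq_nonneg _
      have h3 := ((tendsto_jacobiTheta.pow n).inv₀ (by simp)).isBigO_one ℂ
      simp only [mul_zero, zero_mul] at h2
      refine ((h2.trans h1).mul h3).congr (fun τ ↦ ?_) (fun τ ↦ ?_)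
      · rw [div_eq_mul_inv]
      · simp)
    (by
      -- The shadow series is O(q^((n−8k)/4)) while θ₂ⁿ ~ 2ⁿq^(n/4), so the quotient has a pole of
      -- order at most k in q².
      have h2 := isBigO_translateTheta (Λ := Λ) ((1 / 2 : ℝ) • w) (c := (n - 8 * k : ℝ) / 4)
        fun x hx ↦ div_four_le_norm_sq_shadow hΛ.1 hΛ.2 hw hx
      have h3 := ((tendsto_theta2.pow n).inv₀ (by simp)).isBigO_one ℂ
      have h4 := ((isBigO_refl (fun τ : ℂ ↦ cexp (2 * Real.pi * I * τ) ^ k *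
        cexp (-(Real.pi * I * τ / 4)) ^ n) (comap im atTop)).mul
          (isBigO_ofReal_right.2 h2)).mul h3
      refine (h4.congr' ?_ EventuallyEq.rfl).trans (isBigO_of_le _ fun τ ↦ ?_)
      · filter_upwards [eventually_im_pos] with τ hτ
        rw [hcusp τ hτ]
        have := theta2_ne_zero hτ
        have := Complex.exp_ne_zero (-(Real.pi * I * τ / 4))
        rw [mul_pow]
        field_simp
      · simp only [mul_one, Pi.one_apply, norm_one, norm_mul, norm_pow, Complex.norm_exp,
          Complex.norm_real]
        rw [Real.norm_of_nonneg (Real.exp_pos _).le, ← Real.exp_nat_mul, ← Real.exp_nat_mul,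
          ← Real.exp_add, ← Real.exp_add, Real.exp_le_one_iff]
        have e1 : (2 * Real.pi * I * τ : ℂ).re = -(2 * Real.pi * τ.im) := by simp
        have e2 : (-(Real.pi * I * τ / 4) : ℂ).re = Real.pi * τ.im / 4 := by
          rw [show -(Real.pi * I * τ / 4) = ((-Real.pi / 4 : ℝ) : ℂ) * (I * τ) by push_cast; ring,
            re_ofReal_mul]
          simp
          ring
        rw [e1, e2]
        apply le_of_eq
        ring)
  refine ⟨P, hP, fun τ hτ ↦ ⟨?_, ?_⟩⟩
  · rw [← h τ hτ, mul_div_cancel₀ _ (pow_ne_zero _ (jacobiTheta_ne_zero hτ))]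
  · rw [← haupt_one_sub_one_div hτ, ← h _ (im_one_sub_one_div_pos hτ), hcusp τ hτ,
      mul_div_cancel₀ _ (pow_ne_zero _ (theta2_ne_zero hτ))]

end Lattice

end BelfioreSole

/-! ### Calculus of expansions in q up to order 4 -/

namespace BelfioreSole

open Complex Filter Topology Asymptotics

instance neBot_comap_im_atTop : (comap im atTop).NeBot :=
  tendsto_mul_I_comap_im.neBot

/-- `f τ = c₀ + c₁ q + c₂ q² + c₃ q³ + c₄ q⁴ + O(q⁵)` as `im τ → ∞`, where `q = exp (π i τ)`. -/
def HasExpansion (f : ℂ → ℂ) (c₀ c₁ c₂ c₃ c₄ : ℂ) : Prop :=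
  (fun τ ↦ f τ - (c₀ + c₁ * cexp (Real.pi * I * τ) + c₂ * cexp (Real.pi * I * τ) ^ 2 +
    c₃ * cexp (Real.pi * I * τ) ^ 3 + c₄ * cexp (Real.pi * I * τ) ^ 4)) =O[comap im atTop]
      fun τ ↦ cexp (Real.pi * I * τ) ^ 5

theorem isBigO_cexp_pow_mul (p : Polynomial ℂ) (k : ℕ) :
    (fun τ ↦ cexp (Real.pi * I * τ) ^ k * p.eval (cexp (Real.pi * I * τ))) =O[comap im atTop]
      fun τ ↦ cexp (Real.pi * I * τ) ^ k := by
  simpa using (isBigO_refl (fun τ ↦ cexp (Real.pi * I * τ) ^ k) (comap im atTop)).mul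
    (((p.continuous.tendsto 0).comp tendsto_cexp_pi_I_mul).isBigO_one ℂ)

/-- The constant term is the limit as q → 0; dividing by q lowers m by one. Uniqueness of expansion
coefficients rests on this. -/
theorem coeff_eq_zero_of_isBigO {m : ℕ} : ∀ {p : Polynomial ℂ},
    (fun τ ↦ p.eval (cexp (Real.pi * I * τ))) =O[comap im atTop]
      (fun τ ↦ cexp (Real.pi * I * τ) ^ m) → ∀ i < m, p.coeff i = 0 := by
  induction m with
  | zero => intro p _ i hi; omega
  | succ m ih =>
    intro p hp i hi
    have h0 : p.coeff 0 = 0 := by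
      have h1 : Tendsto (fun τ ↦ cexp (Real.pi * I * τ) ^ (m + 1)) (comap im atTop) (𝓝 0) := by
        simpa using tendsto_cexp_pi_I_mul.pow (m + 1)
      have h2 := (p.continuous.tendsto 0).comp tendsto_cexp_pi_I_mul
      rw [Polynomial.coeff_zero_eq_eval_zero]
      exact tendsto_nhds_unique h2 (hp.trans_tendsto h1)
    have hX : ∀ z, p.eval z = z * p.divX.eval z := fun z ↦ by
      conv_lhs => rw [← p.X_mul_divX_add]
      simp [h0]
    cases i with
    | zero => exact h0
    | succ i =>
      rw [← Polynomial.coeff_divX]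
      refine ih ?_ i (by omega)
      refine ((isBigO_refl (fun τ ↦ (cexp (Real.pi * I * τ))⁻¹) _).mul hp).congr
        (fun τ ↦ ?_) fun τ ↦ ?_
      · rw [hX, inv_mul_cancel_left₀ (Complex.exp_ne_zero _)]
      · rw [pow_succ', inv_mul_cancel_left₀ (Complex.exp_ne_zero _)]

namespace HasExpansion

variable {f g : ℂ → ℂ} {c₀ c₁ c₂ c₃ c₄ d₀ d₁ d₂ d₃ d₄ : ℂ}

theorem congr_fun (hf : HasExpansion f c₀ c₁ c₂ c₃ c₄) (h : ∀ τ : ℂ, 0 < τ.im → f τ = g τ) :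
    HasExpansion g c₀ c₁ c₂ c₃ c₄ := by
  refine hf.congr' ?_ EventuallyEq.rfl
  filter_upwards [eventually_im_pos] with τ hτ
  rw [h τ hτ]

theorem congr_coeff (hf : HasExpansion f c₀ c₁ c₂ c₃ c₄) (h₀ : c₀ = d₀) (h₁ : c₁ = d₁)
    (h₂ : c₂ = d₂) (h₃ : c₃ = d₃) (h₄ : c₄ = d₄) : HasExpansion f d₀ d₁ d₂ d₃ d₄ := by
  subst h₀ h₁ h₂ h₃ h₄
  exact hf

theorem const (c : ℂ) : HasExpansion (fun _ ↦ c) c 0 0 0 0 := by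
  simpa [HasExpansion] using isBigO_zero _ _

theorem nome : HasExpansion (fun τ ↦ cexp (Real.pi * I * τ)) 0 1 0 0 0 := by
  simpa [HasExpansion] using isBigO_zero _ _

theorem add (hf : HasExpansion f c₀ c₁ c₂ c₃ c₄) (hg : HasExpansion g d₀ d₁ d₂ d₃ d₄) :
    HasExpansion (fun τ ↦ f τ + g τ) (c₀ + d₀) (c₁ + d₁) (c₂ + d₂) (c₃ + d₃) (c₄ + d₄) :=
  (IsBigO.add hf hg).congr_left fun τ ↦ by ring

theorem tendsto (hf : HasExpansion f c₀ c₁ c₂ c₃ c₄) : Tendsto f (comap im atTop) (𝓝 c₀) := by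
  have h1 : Tendsto (fun τ ↦ Complex.exp (Real.pi * I * τ) ^ 5) (comap im atTop) (𝓝 0) := by
    simpa using tendsto_cexp_pi_I_mul.pow 5
  have h2 := (hf.trans_tendsto h1).add ((((tendsto_const_nhds (x := c₀)).add
    (tendsto_cexp_pi_I_mul.const_mul c₁)).add ((tendsto_cexp_pi_I_mul.pow 2).const_mul c₂)).add
      ((tendsto_cexp_pi_I_mul.pow 3).const_mul c₃) |>.add
        ((tendsto_cexp_pi_I_mul.pow 4).const_mul c₄))
  simpa using h2

theorem mul (hf : HasExpansion f c₀ c₁ c₂ c₃ c₄) (hg : HasExpansion g d₀ d₁ d₂ d₃ d₄) :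
    HasExpansion (fun τ ↦ f τ * g τ) (c₀ * d₀) (c₀ * d₁ + c₁ * d₀) (c₀ * d₂ + c₁ * d₁ + c₂ * d₀)
      (c₀ * d₃ + c₁ * d₂ + c₂ * d₁ + c₃ * d₀)
      (c₀ * d₄ + c₁ * d₃ + c₂ * d₂ + c₃ * d₁ + c₄ * d₀) := by
  have h1 := IsBigO.mul hf (hg.tendsto.isBigO_one ℂ)
  have h2 := IsBigO.mul (isBigO_cexp_pow_mul (.C c₀ + .C c₁ * .X + .C c₂ * .X ^ 2 +
    .C c₃ * .X ^ 3 + .C c₄ * .X ^ 4) 0) hg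
  -- These are the terms q⁵ to q⁸ in the product of the two truncations.
  have h3 := isBigO_cexp_pow_mul (.C (c₁ * d₄ + c₂ * d₃ + c₃ * d₂ + c₄ * d₁) +
    .C (c₂ * d₄ + c₃ * d₃ + c₄ * d₂) * .X + .C (c₃ * d₄ + c₄ * d₃) * .X ^ 2 +
    .C (c₄ * d₄) * .X ^ 3) 5
  simp only [mul_one, pow_zero, one_mul] at h1 h2
  refine ((h1.add h2).add h3).congr_left fun τ ↦ ?_
  simp only [Polynomial.eval_add, Polynomial.eval_mul, Polynomial.eval_C, Polynomial.eval_X,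
    Polynomial.eval_pow]
  ring

theorem const_mul (c : ℂ) (hf : HasExpansion f c₀ c₁ c₂ c₃ c₄) :
    HasExpansion (fun τ ↦ c * f τ) (c * c₀) (c * c₁) (c * c₂) (c * c₃) (c * c₄) :=
  ((const c).mul hf).congr_coeff (by ring) (by ring) (by ring) (by ring) (by ring)

theorem unique (hf : HasExpansion f c₀ c₁ c₂ c₃ c₄) (hg : HasExpansion f d₀ d₁ d₂ d₃ d₄) :
    c₀ = d₀ ∧ c₁ = d₁ ∧ c₂ = d₂ ∧ c₃ = d₃ ∧ c₄ = d₄ := by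
  have h := coeff_eq_zero_of_isBigO (m := 5) (p := .C (d₀ - c₀) + .C (d₁ - c₁) * .X +
    .C (d₂ - c₂) * .X ^ 2 + .C (d₃ - c₃) * .X ^ 3 + .C (d₄ - c₄) * .X ^ 4) <| by
      refine (IsBigO.sub hf hg).congr_left fun τ ↦ ?_
      simp only [Polynomial.eval_add, Polynomial.eval_mul, Polynomial.eval_C, Polynomial.eval_X,
        Polynomial.eval_pow]
      ring
  have h0 := h 0 (by norm_num)
  have h1 := h 1 (by norm_num)
  have h2 := h 2 (by norm_num)
  have h3 := h 3 (by norm_num)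
  have h4 := h 4 (by norm_num)
  simp [Polynomial.coeff_X, Polynomial.coeff_X_pow, Polynomial.coeff_C, -map_sub] at h0 h1 h2 h3 h4
  exact ⟨(sub_eq_zero.1 h0).symm, (sub_eq_zero.1 h1).symm, (sub_eq_zero.1 h2).symm,
    (sub_eq_zero.1 h3).symm, (sub_eq_zero.1 h4).symm⟩

/-- Division of expansions. -/
theorem of_mul (hf : HasExpansion f c₀ c₁ c₂ c₃ c₄) (hc : c₀ ≠ 0)
    (hfg : HasExpansion (fun τ ↦ f τ * g τ) (c₀ * d₀) (c₀ * d₁ + c₁ * d₀)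
      (c₀ * d₂ + c₁ * d₁ + c₂ * d₀) (c₀ * d₃ + c₁ * d₂ + c₂ * d₁ + c₃ * d₀)
      (c₀ * d₄ + c₁ * d₃ + c₂ * d₂ + c₃ * d₁ + c₄ * d₀)) : HasExpansion g d₀ d₁ d₂ d₃ d₄ := by
  have hd : HasExpansion (fun τ ↦ d₀ + d₁ * Complex.exp (Real.pi * I * τ) +
      d₂ * Complex.exp (Real.pi * I * τ) ^ 2 + d₃ * Complex.exp (Real.pi * I * τ) ^ 3 +
      d₄ * Complex.exp (Real.pi * I * τ) ^ 4) d₀ d₁ d₂ d₃ d₄ := by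
    simpa [HasExpansion] using isBigO_zero _ _
  -- With d the candidate truncation, g − d = f⁻¹(fg − fd); fg and fd have the same expansion and
  -- f⁻¹ is bounded.
  refine (((hf.tendsto.inv₀ hc).isBigO_one ℂ).mul (IsBigO.sub hfg (hf.mul hd))).congr' ?_ ?_
  · filter_upwards [hf.tendsto.eventually_ne hc] with τ hτ
    field_simp
    ring
  · filter_upwards with τ
    simp

theorem of_isBigO_exp {c : ℝ} (hc : 5 ≤ c) {c₀ c₁ c₂ c₃ c₄ : ℂ}
    (h : (fun τ ↦ f τ - (c₀ + c₁ * Complex.exp (Real.pi * I * τ) +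
      c₂ * Complex.exp (Real.pi * I * τ) ^ 2 + c₃ * Complex.exp (Real.pi * I * τ) ^ 3 +
      c₄ * Complex.exp (Real.pi * I * τ) ^ 4)) =O[comap im atTop]
        fun τ ↦ Real.exp (-Real.pi * c * τ.im)) : HasExpansion f c₀ c₁ c₂ c₃ c₄ := by
  refine h.trans (IsBigO.of_bound 1 ?_)
  filter_upwards [eventually_im_pos] with τ hτ
  rw [← Complex.exp_nat_mul, Real.norm_of_nonneg (Real.exp_pos _).le, Complex.norm_exp, one_mul,
    Real.exp_le_exp]
  simp only [Nat.cast_ofNat, mul_re, I_re, mul_zero, ofReal_im, I_im, mul_one, sub_self,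
    mul_im, zero_mul, add_zero, ofReal_re, zero_sub, im_ofNat, re_ofNat, sub_zero]
  nlinarith [mul_le_mul_of_nonneg_right hc (mul_pos Real.pi_pos hτ).le]

/-- The coefficients of a theta series count the vectors of given norm. -/
theorem tsum {ι : Type*} {m : ι → ℕ}
    (hs : ∀ ε > 0, Summable fun x ↦ Real.exp (-Real.pi * ε * (m x : ℝ))) :
    HasExpansion (fun τ ↦ ∑' x, Complex.exp (Real.pi * I * τ * (m x : ℝ)))
      {x | m x = 0}.ncard {x | m x = 1}.ncard {x | m x = 2}.ncard {x | m x = 3}.ncard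
      {x | m x = 4}.ncard := by
  classical
  have hfin : {x | m x < 5}.Finite := by
    have h := (hs 1 one_pos).tendsto_cofinite_zero.eventually_lt_const
      (Real.exp_pos (-Real.pi * 1 * 5))
    refine Set.Finite.subset (Filter.eventually_cofinite.1 h) fun x hx ↦ ?_
    have hx' : (m x : ℝ) ≤ 5 := by exact_mod_cast (le_of_lt hx)
    rw [Set.mem_ofPred_eq, Real.exp_lt_exp, not_lt]
    nlinarith [Real.pi_pos]
  refine of_isBigO_exp le_rfl ((isBigO_tsum_cexp_sub_sum hfin.toFinset (c := 5) ?_ hs).congr_left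
    fun τ ↦ ?_)
  · intro x hx
    have : ¬ m x < 5 := by simpa using hx
    exact_mod_cast not_lt.1 this
  · have hcard : ∀ j < 5, ({x ∈ hfin.toFinset | m x = j}.card : ℂ) = {x | m x = j}.ncard := by
      intro j hj
      rw [← Set.ncard_coe_finset]
      congr 2
      ext x
      simp only [Finset.coe_filter, Set.Finite.mem_toFinset, Set.mem_ofPred_eq, and_iff_right_iff_imp]
      rintro rfl
      exact hj
    have hsum : ∑ x ∈ hfin.toFinset, Complex.exp (Real.pi * I * τ * (m x : ℝ)) =
        ∑ j ∈ Finset.range 5, ({x | m x = j}.ncard : ℂ) * Complex.exp (Real.pi * I * τ) ^ j := by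
      rw [← Finset.sum_fiberwise_of_maps_to (g := m) (t := Finset.range 5)
        (fun x hx ↦ by simpa using hx)]
      refine Finset.sum_congr rfl fun j hj ↦ ?_
      rw [Finset.sum_congr rfl (g := fun _ ↦ Complex.exp (Real.pi * I * τ) ^ j), Finset.sum_const,
        nsmul_eq_mul, hcard j (Finset.mem_range.1 hj)]
      intro x hx
      rw [(Finset.mem_filter.1 hx).2, ← Complex.exp_nat_mul]
      congr 1
      push_cast
      ring
    rw [hsum]
    simp [Finset.sum_range_succ]

end HasExpansion

end BelfioreSole

/-! ### Expansions of the theta constants and of the Hauptmodul at both cusps -/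

namespace BelfioreSole

open Complex Filter Topology Asymptotics

namespace HasExpansion

variable {f g : ℂ → ℂ} {c₀ c₁ c₂ c₃ c₄ d₀ d₁ d₂ d₃ d₄ : ℂ}

theorem sq (hf : HasExpansion f c₀ c₁ c₂ c₃ c₄) :
    HasExpansion (fun τ ↦ f τ ^ 2) (c₀ ^ 2) (2 * c₀ * c₁) (2 * c₀ * c₂ + c₁ ^ 2)
      (2 * (c₀ * c₃ + c₁ * c₂)) (2 * (c₀ * c₄ + c₁ * c₃) + c₂ ^ 2) :=
  ((hf.mul hf).congr_coeff (by ring) (by ring) (by ring) (by ring) (by ring)).congr_fun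
    fun τ _ ↦ (_root_.sq (f τ)).symm

theorem comp_add_one (hf : HasExpansion f c₀ c₁ c₂ c₃ c₄) :
    HasExpansion (fun τ ↦ f (τ + 1)) c₀ (-c₁) c₂ (-c₃) c₄ := by
  have h := IsBigO.comp_tendsto hf tendsto_add_one_comap_im
  simp only [Function.comp_def, cexp_add_one] at h
  refine (h.trans (isBigO_of_le _ fun τ ↦ ?_)).congr_left fun τ ↦ ?_
  · simp
  · ring

end HasExpansion

theorem hasExpansion_jacobiTheta : HasExpansion jacobiTheta 1 2 0 0 2 :=
  .of_isBigO_exp le_rfl (isBigO_jacobiTheta_sub.congr_left fun τ ↦ by ring)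

theorem hasExpansion_theta4 : HasExpansion theta4 1 (-2) 0 0 2 :=
  hasExpansion_jacobiTheta.comp_add_one.congr_coeff rfl rfl rfl (by ring) rfl

/-- The theta constant `θ₂`, normalised to be a power series with constant coefficient `1`. -/
noncomputable def normTheta2 (τ : ℂ) : ℂ := cexp (-(Real.pi * I * τ / 4)) * theta2 τ / 2

theorem hasExpansion_normTheta2 : HasExpansion normTheta2 1 0 1 0 0 :=
  .of_isBigO_exp (c := 6) (by norm_num) <| by
    refine (isBigO_theta2_sub.const_mul_left (1 / 2)).congr_left fun τ ↦ ?_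
    rw [normTheta2]
    ring

theorem theta2_eq (τ : ℂ) : theta2 τ = 2 * cexp (Real.pi * I * τ / 4) * normTheta2 τ := by
  have : cexp (Real.pi * I * τ / 4) * cexp (-(Real.pi * I * τ / 4)) = 1 := by
    rw [← Complex.exp_add, add_neg_cancel, Complex.exp_zero]
  rw [normTheta2]
  linear_combination -theta2 τ * this

theorem normTheta2_ne_zero {τ : ℂ} (hτ : 0 < τ.im) : normTheta2 τ ≠ 0 := fun h ↦
  theta2_ne_zero hτ (by rw [theta2_eq, h, mul_zero])

theorem theta2_pow_four (τ : ℂ) :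
    theta2 τ ^ 4 = 16 * cexp (Real.pi * I * τ) * normTheta2 τ ^ 4 := by
  rw [theta2_eq, mul_pow, mul_pow, ← Complex.exp_nat_mul]
  norm_num
  left
  congr 1
  ring

/-- Power series division in θ₃⁸ · `haupt` = q · `normTheta2`⁴ · θ₄⁴; the factor 16 of θ₂⁴ cancels.
-/
theorem hasExpansion_haupt : HasExpansion haupt 0 1 (-24) 300 (-2624) := by
  have h3 := hasExpansion_jacobiTheta.sq.sq.sq
  have h := HasExpansion.nome.mul (hasExpansion_normTheta2.sq.sq.mul hasExpansion_theta4.sq.sq)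
  refine h3.of_mul (by norm_num) ((h.congr_fun fun τ hτ ↦ ?_).congr_coeff
    (by norm_num) (by norm_num) (by norm_num) (by norm_num) (by norm_num))
  have := jacobiTheta_ne_zero hτ
  rw [haupt, theta2_pow_four]
  field_simp

/-- The regular part of the Hauptmodul at the second cusp. -/
noncomputable def hauptShadowReg (τ : ℂ) : ℂ :=
  (jacobiTheta τ ^ 2) ^ 2 * (theta4 τ ^ 2) ^ 2 / ((normTheta2 τ ^ 2) ^ 2) ^ 2

theorem hauptShadow_eq (τ : ℂ) :
    hauptShadow τ = -1 / 4096 * hauptShadowReg τ / cexp (Real.pi * I * τ) ^ 2 := by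
  have h : theta2 τ ^ 8 = (theta2 τ ^ 4) ^ 2 := by ring
  have := Complex.exp_ne_zero (Real.pi * I * τ)
  rw [hauptShadow, hauptShadowReg, h, theta2_pow_four]
  rcases eq_or_ne (normTheta2 τ) 0 with h0 | h0
  · simp [h0]
  · field_simp
    ring

theorem hasExpansion_hauptShadowReg : HasExpansion hauptShadowReg 1 0 (-24) 0 276 := by
  refine hasExpansion_normTheta2.sq.sq.sq.of_mul (by norm_num)
    (((hasExpansion_jacobiTheta.sq.sq.mul hasExpansion_theta4.sq.sq).congr_fun
      fun τ hτ ↦ ?_).congr_coeff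
        (by norm_num) (by norm_num) (by norm_num) (by norm_num) (by norm_num))
  have := normTheta2_ne_zero hτ
  rw [hauptShadowReg]
  field_simp

theorem hasExpansion_jacobiTheta_pow (n : ℕ) : HasExpansion (fun τ ↦ jacobiTheta τ ^ n) 1 (2 * n)
    (2 * n * (n - 1)) (4 / 3 * n * (n - 1) * (n - 2))
    (2 / 3 * n * (n - 1) * (n - 2) * (n - 3) + 2 * n) := by
  induction n with
  | zero => exact ((HasExpansion.const 1).congr_coeff rfl (by simp) (by simp) (by simp)
      (by simp)).congr_fun fun τ _ ↦ (pow_zero _).symm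
  | succ n ih =>
    refine ((ih.mul hasExpansion_jacobiTheta).congr_fun fun τ _ ↦ (pow_succ _ _).symm).congr_coeff
      ?_ ?_ ?_ ?_ ?_ <;> push_cast <;> ring

theorem hasExpansion_normTheta2_pow (n : ℕ) : HasExpansion (fun τ ↦ normTheta2 τ ^ n) 1 0 n 0
    (n * (n - 1) / 2) := by
  induction n with
  | zero => exact ((HasExpansion.const 1).congr_coeff rfl (by simp) (by simp) (by simp)
      (by simp)).congr_fun fun τ _ ↦ (pow_zero _).symm
  | succ n ih =>
    refine ((ih.mul hasExpansion_normTheta2).congr_fun fun τ _ ↦ (pow_succ _ _).symm).congr_coeff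
      ?_ ?_ ?_ ?_ ?_ <;> push_cast <;> ring

/-- Because `haupt` starts with q, the system is unitriangular in the coefficients of P, and the
degree 5 term is invisible below q⁵. -/
theorem hasExpansion_eval_haupt {P : Polynomial ℂ} (hP : P.natDegree ≤ 5) :
    HasExpansion (fun τ ↦ P.eval (haupt τ)) (P.coeff 0) (P.coeff 1)
      (-24 * P.coeff 1 + P.coeff 2) (300 * P.coeff 1 - 48 * P.coeff 2 + P.coeff 3)
      (-2624 * P.coeff 1 + 1176 * P.coeff 2 - 72 * P.coeff 3 + P.coeff 4) := by
  have h1 := hasExpansion_haupt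
  have h2 := h1.sq
  have h3 := h1.mul h2
  have h4 := h2.sq
  have h5 := h1.mul h4
  refine (((((HasExpansion.const (P.coeff 0)).add (h1.const_mul (P.coeff 1))).add
    (h2.const_mul (P.coeff 2))).add (h3.const_mul (P.coeff 3))).add
      (h4.const_mul (P.coeff 4))).add (h5.const_mul (P.coeff 5)) |>.congr_fun
        (fun τ _ ↦ ?_) |>.congr_coeff ?_ ?_ ?_ ?_ ?_
  · rw [Polynomial.eval_eq_sum_range' (Nat.lt_succ_of_le hP)]
    simp only [Finset.sum_range_succ, Finset.sum_range_zero]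
    ring
  all_goals ring

/-- The factor q¹⁰ clears the pole. Degree j contributes from q^(10−2j) on, so here the top
coefficients of P are the visible ones. -/
theorem hasExpansion_eval_hauptShadow {P : Polynomial ℂ} (hP : P.natDegree ≤ 5) :
    HasExpansion (fun τ ↦ cexp (Real.pi * I * τ) ^ 10 * P.eval (hauptShadow τ))
      ((-1 / 4096) ^ 5 * P.coeff 5) 0
      (-120 * ((-1 / 4096) ^ 5 * P.coeff 5) + (-1 / 4096) ^ 4 * P.coeff 4) 0
      (7140 * ((-1 / 4096) ^ 5 * P.coeff 5) - 96 * ((-1 / 4096) ^ 4 * P.coeff 4) +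
        (-1 / 4096) ^ 3 * P.coeff 3) := by
  have hq := HasExpansion.nome.sq
  have h1 := hasExpansion_hauptShadowReg.const_mul (-1 / 4096)
  have h2 := h1.sq
  have h3 := h1.mul h2
  have h4 := h2.sq
  have h5 := h1.mul h4
  refine ((((((hq.sq.sq.mul hq).const_mul (P.coeff 0)).add
    ((hq.sq.sq.mul h1).const_mul (P.coeff 1))).add
    (((hq.sq.mul hq).mul h2).const_mul (P.coeff 2))).add
    ((hq.sq.mul h3).const_mul (P.coeff 3))).add
      ((hq.mul h4).const_mul (P.coeff 4))).add (h5.const_mul (P.coeff 5)) |>.congr_fun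
        (fun τ _ ↦ ?_) |>.congr_coeff ?_ ?_ ?_ ?_ ?_
  · have := Complex.exp_ne_zero (Real.pi * I * τ)
    rw [Polynomial.eval_eq_sum_range' (Nat.lt_succ_of_le hP)]
    simp only [Finset.sum_range_succ, Finset.sum_range_zero, hauptShadow_eq]
    field_simp
    ring
  all_goals ring

end BelfioreSole

/-! ### Counting short vectors of the lattice and of its shadow -/

namespace BelfioreSole

open Module Complex Filter Topology Asymptotics

section Lattice

variable {n : ℕ} {Λ : Submodule ℤ (EuclideanSpace ℝ (Fin n))}

theorem summable_exp_of_norm_sq_eq [DiscreteTopology Λ] {u : EuclideanSpace ℝ (Fin n)} {c : ℝ}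
    {m : Λ → ℕ} (hm : ∀ x : Λ, ‖(x : EuclideanSpace ℝ (Fin n)) + u‖ ^ 2 = c + m x) {ε : ℝ}
    (hε : 0 < ε) : Summable fun x : Λ ↦ Real.exp (-Real.pi * ε * (m x : ℝ)) := by
  refine ((summable_exp_pi_mul (Λ := Λ) u hε).mul_left (Real.exp (Real.pi * ε * c))).congr
    fun x ↦ ?_
  rw [hm, ← Real.exp_add]
  congr 1
  ring

/-- The theta function of a lattice without vectors of norm `1`, `2` and `3`. -/
theorem hasExpansion_translateTheta_zero [DiscreteTopology Λ] [IsZLattice ℝ Λ]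
    (hΛ : IsUnimodular Λ) (h3 : ∀ x ∈ Λ, x ≠ 0 → 3 < ‖x‖ ^ 2) :
    ∃ N : ℕ, HasExpansion (translateTheta Λ 0) 1 0 0 0 N := by
  have hex : ∀ x : Λ, ∃ m : ℕ, ‖(x : EuclideanSpace ℝ (Fin n)) + 0‖ ^ 2 = 0 + (m : ℝ) := by
    intro x
    obtain ⟨k, hk⟩ := hΛ.1 x x.2 x x.2
    rw [real_inner_self_eq_norm_sq] at hk
    have h0 : (0 : ℝ) ≤ k := hk ▸ sq_nonneg _
    lift k to ℕ using (by exact_mod_cast h0)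
    exact ⟨k, by simpa using hk⟩
  choose m hm using hex
  have hzero : {x | m x = 0} = {0} := by
    ext x
    have := hm x
    simp only [Set.mem_ofPred_eq, Set.mem_singleton_iff]
    constructor
    · intro h
      rw [h] at this
      simpa using this
    · rintro rfl
      have h0 : (0 : ℝ) = m 0 := by simpa using this
      exact_mod_cast h0.symm
  have hempty : ∀ j, 0 < j → j ≤ 3 → {x | m x = j} = ∅ := by
    intro j hj hj3
    rw [Set.eq_empty_iff_forall_notMem]
    intro x hx
    have hx' : m x = j := hx
    have hx0 : (x : EuclideanSpace ℝ (Fin n)) ≠ 0 := by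
      intro h
      have : x ∈ {x | m x = 0} := by rw [hzero]; exact Subtype.ext h
      have : m x = 0 := this
      omega
    have h1 := h3 x x.2 hx0
    have h2 := hm x
    rw [add_zero, zero_add] at h2
    rw [h2, hx'] at h1
    have : 3 < j := by exact_mod_cast h1
    omega
  refine ⟨{x | m x = 4}.ncard, ((HasExpansion.tsum fun ε hε ↦
    summable_exp_of_norm_sq_eq hm hε).congr_fun fun τ _ ↦ ?_).congr_coeff ?_ ?_ ?_ ?_ rfl⟩
  · refine tsum_congr fun x ↦ ?_
    rw [hm, zero_add]
  · simp [hzero]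
  · simp [hempty 1]
  · simp [hempty 2]
  · simp [hempty 3]

/-- Few vectors in a translate of a lattice with large minimum are close to the minimal norm: they
are pairwise incongruent modulo `2 Λ`. -/
theorem ncard_add_ncard_le [DiscreteTopology Λ] [IsZLattice ℝ Λ]
    (h3 : ∀ x ∈ Λ, x ≠ 0 → 3 < ‖x‖ ^ 2) {u : EuclideanSpace ℝ (Fin n)} {c : ℝ} {m : Λ → ℕ}
    (hm : ∀ x : Λ, ‖(x : EuclideanSpace ℝ (Fin n)) + u‖ ^ 2 = c + m x) :
    {x | m x = 0}.ncard + {x | m x = 2}.ncard ≤ 2 ^ n := by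
  obtain ⟨b⟩ := nonempty_basis_fin (Λ := Λ)
  let f : Λ → Fin n → ZMod 2 := fun x i ↦ ((b.repr x i : ℤ) : ZMod 2)
  have hinj : Set.InjOn f ({x | m x = 0} ∪ {x | m x = 2}) := by
    intro x hx y hy hxy
    have hx' : m x ≤ 2 := by rcases hx with h | h <;> exact (le_of_eq h).trans (by norm_num)
    have hy' : m y ≤ 2 := by rcases hy with h | h <;> exact (le_of_eq h).trans (by norm_num)
    have hdvd : ∀ i, ∃ k : ℤ, b.repr x i - b.repr y i = 2 * k := by
      intro i
      have h := congrFun hxy i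
      exact (ZMod.intCast_eq_intCast_iff_dvd_sub _ _ 2).1 h.symm
    choose k hk using hdvd
    let d : Λ := b.equivFun.symm k
    have hd : x - y = (2 : ℤ) • d := by
      apply b.repr.injective
      ext i
      rw [map_sub, map_smul, Finsupp.sub_apply, hk, Finsupp.smul_apply, smul_eq_mul]
      congr 1
      exact (congrFun (b.equivFun.apply_symm_apply k) i).symm
    have hd' : x = y + (2 : ℤ) • d := by rw [← hd]; abel
    -- If x = y + 2d, the midpoint y + d + u has norm at least c, so the law gives m x + m y ≥
    -- 2‖d‖². For d ≠ 0 the right side exceeds 6 while the left is at most 4.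
    have hpar := parallelogram_law_with_norm ℝ
      (((y + d : Λ) : EuclideanSpace ℝ (Fin n)) + u) (d : EuclideanSpace ℝ (Fin n))
    have e1 : ((y + d : Λ) : EuclideanSpace ℝ (Fin n)) + u + d = x + u := by
      rw [hd']
      push_cast
      rw [two_smul]
      abel
    have e2 : ((y + d : Λ) : EuclideanSpace ℝ (Fin n)) + u - d = y + u := by
      push_cast
      abel
    rw [e1, e2] at hpar
    simp only [hm] at hpar
    by_cases h0 : (d : EuclideanSpace ℝ (Fin n)) = 0
    · have : d = 0 := Subtype.ext h0
      rw [hd', this, smul_zero, add_zero]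
    · have h1 := h3 d d.2 h0
      have h2 : (0 : ℝ) ≤ m (y + d) := Nat.cast_nonneg _
      have h4 : (m x : ℝ) ≤ 2 := by exact_mod_cast hx'
      have h5 : (m y : ℝ) ≤ 2 := by exact_mod_cast hy'
      linarith
  have hfin : ({x | m x = 0} ∪ {x | m x = 2}).Finite :=
    Set.Finite.of_finite_image (Set.toFinite _) hinj
  rw [← Set.ncard_union_eq (Set.disjoint_left.2 fun x h0 h2 ↦ by
    have h0' : m x = 0 := h0
    have h2' : m x = 2 := h2
    omega) (hfin.subset Set.subset_union_left) (hfin.subset Set.subset_union_right),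
    ← hinj.ncard_image]
  refine (Set.ncard_le_ncard (Set.subset_univ _)).trans (le_of_eq ?_)
  rw [Set.ncard_univ]
  simp

/-- The theta function of the shadow, normalised by the norm of a shortest characteristic vector. -/
theorem hasExpansion_translateTheta_shadow [DiscreteTopology Λ] [IsZLattice ℝ Λ] {k : ℕ}
    (hΛ : IsNSubEightKLattice k Λ) (h3 : ∀ x ∈ Λ, x ≠ 0 → 3 < ‖x‖ ^ 2)
    {w : EuclideanSpace ℝ (Fin n)} (hw : IsCharacteristic Λ w) (hw' : ⟪w, w⟫_ℝ = n - 8 * k) :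
    ∃ m₀ m₁ m₂ m₃ m₄ : ℕ, m₀ + m₂ ≤ 2 ^ n ∧
      HasExpansion (fun τ ↦ cexp (-(Real.pi * I * τ * ((n - 8 * k) / 4))) *
        translateTheta Λ ((1 / 2 : ℝ) • w) τ) m₀ m₁ m₂ m₃ m₄ := by
  have hex : ∀ x : Λ, ∃ m : ℕ, ‖(x : EuclideanSpace ℝ (Fin n)) + (1 / 2 : ℝ) • w‖ ^ 2 =
      (n - 8 * k : ℝ) / 4 + (m : ℝ) := by
    intro x
    obtain ⟨a, ha⟩ := hΛ.1.1 x x.2 x x.2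
    obtain ⟨b, hb⟩ := hw.2 x x.2
    have hge := div_four_le_norm_sq_shadow hΛ.1 hΛ.2 hw x.2
    -- With (x, x) = a and (w, x) = a + 2b, the excess over ‖w‖²/4 is 2a + 2b.
    have heq : ‖(x : EuclideanSpace ℝ (Fin n)) + (1 / 2 : ℝ) • w‖ ^ 2 =
        (n - 8 * k : ℝ) / 4 + ((2 * a + 2 * b : ℤ) : ℝ) := by
      rw [norm_add_sq_real, real_inner_smul_right, real_inner_comm, norm_smul, mul_pow,
        ← real_inner_self_eq_norm_sq, ← real_inner_self_eq_norm_sq w, hw']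
      rw [ha] at hb ⊢
      norm_num
      linarith
    have h0 : (0 : ℝ) ≤ ((2 * a + 2 * b : ℤ) : ℝ) := by linarith
    generalize 2 * a + 2 * b = j at heq h0
    lift j to ℕ using (by exact_mod_cast h0)
    exact ⟨j, by simpa using heq⟩
  choose m hm using hex
  refine ⟨_, _, _, _, _, ncard_add_ncard_le h3 hm, (HasExpansion.tsum fun ε hε ↦
    summable_exp_of_norm_sq_eq hm hε).congr_fun fun τ _ ↦ ?_⟩
  rw [translateTheta, ← tsum_mul_left]
  refine tsum_congr fun x ↦ ?_
  rw [hm, ← Complex.exp_add]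
  congr 1
  push_cast
  ring

end Lattice

end BelfioreSole

/-! ### The conjecture at τ = i and the coefficients of P -/

namespace BelfioreSole

open Complex Filter Topology Asymptotics

/-- Evaluation of the secrecy function at `1` and at infinity. -/
theorem BelfioreSoleConjecture.theta_one_le (hBS : BelfioreSoleConjecture) {n : ℕ}
    {Λ : Submodule ℤ (EuclideanSpace ℝ (Fin n))} [DiscreteTopology Λ] [IsZLattice ℝ Λ]
    (hΛ : IsUnimodular Λ) (ht : Tendsto (translateTheta Λ 0) (comap im atTop) (𝓝 1)) :
    theta Λ 1 ≤ theta (intLattice n) 1 := by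
  have hre : ∀ Λ' : Submodule ℤ (EuclideanSpace ℝ (Fin n)),
      Tendsto (translateTheta Λ' 0) (comap im atTop) (𝓝 1) → Tendsto (theta Λ') atTop (𝓝 1) := by
    intro Λ' h
    have h2 := (continuous_re.tendsto 1).comp (h.comp tendsto_mul_I_comap_im)
    refine h2.congr fun y ↦ ?_
    rw [Function.comp_apply, Function.comp_apply, ← ofReal_theta, ofReal_re]
  have hZ : Tendsto (translateTheta (intLattice n) 0) (comap im atTop) (𝓝 1) := by
    have h := tendsto_jacobiTheta.pow n
    rw [one_pow] at h
    refine h.congr' ?_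
    filter_upwards [eventually_im_pos] with τ hτ
    exact (translateTheta_intLattice hτ).symm
  have hlim := (hre _ hZ).div (hre _ ht) one_ne_zero
  rw [div_one] at hlim
  -- Both theta functions tend to 1 as y → ∞, hence so does their quotient, whose values never
  -- exceed the one at 1.
  have hge : 1 ≤ secrecyFunction Λ 1 := by
    refine le_of_tendsto hlim ?_
    filter_upwards [eventually_gt_atTop 0] with y hy
    exact hBS n Λ hΛ hy
  rw [secrecyFunction] at hge
  have h0 : 0 ≤ theta Λ 1 := tsum_nonneg fun _ ↦ (Real.exp_pos _).le
  rcases h0.eq_or_lt with h | h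
  -- A vanishing denominator would make the quotient 0 by convention, against 1 ≤ 0.
  · rw [← h, div_zero] at hge
    norm_num at hge
  · exact (one_le_div h).1 hge

/-- The polynomial of a theta function without terms of exponents `1`, `2` and `3`. -/
theorem coeff_eq_of_hasExpansion {n : ℕ} {P : Polynomial ℂ} (hP : P.natDegree ≤ 5) {N : ℂ}
    (h : HasExpansion (fun τ ↦ jacobiTheta τ ^ n * P.eval (haupt τ)) 1 0 0 0 N) :
    P.coeff 0 = 1 ∧ P.coeff 1 = -2 * n ∧ P.coeff 2 = 2 * n ^ 2 - 46 * n ∧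
      P.coeff 3 = -4 / 3 * n ^ 3 + 92 * n ^ 2 - 4832 / 3 * n ∧
      P.coeff 4 = 2 / 3 * n ^ 4 - 92 * n ^ 3 + 12838 / 3 * n ^ 2 - 67118 * n + N := by
  obtain ⟨h0, h1, h2, h3, h4⟩ :=
    ((hasExpansion_jacobiTheta_pow n).mul (hasExpansion_eval_haupt hP)).unique h
  have e0 : P.coeff 0 = 1 := by linear_combination h0
  rw [e0] at h1 h2 h3 h4
  have e1 : P.coeff 1 = -2 * n := by linear_combination h1
  rw [e1] at h2 h3 h4
  have e2 : P.coeff 2 = 2 * n ^ 2 - 46 * n := by linear_combination h2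
  rw [e2] at h3 h4
  have e3 : P.coeff 3 = -4 / 3 * n ^ 3 + 92 * n ^ 2 - 4832 / 3 * n := by linear_combination h3
  rw [e3] at h4
  exact ⟨e0, e1, e2, e3, by linear_combination h4⟩

/-- Normalising by the minimal shadow norm leaves exactly the factor q^(2k) that clears the pole of
P(`hauptShadow`). -/
theorem cexp_mul_theta2_pow (n k : ℕ) (τ : ℂ) :
    cexp (-(Real.pi * I * τ * ((n - 8 * k) / 4))) * theta2 τ ^ n =
      2 ^ n * (normTheta2 τ ^ n * cexp (Real.pi * I * τ) ^ (2 * k)) := by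
  rw [theta2_eq, mul_pow, mul_pow, ← Complex.exp_nat_mul, ← Complex.exp_nat_mul]
  have : cexp (-(Real.pi * I * τ * ((n - 8 * k) / 4))) * cexp (n * (Real.pi * I * τ / 4)) =
      cexp ((2 * k : ℕ) * (Real.pi * I * τ)) := by
    rw [← Complex.exp_add]
    congr 1
    push_cast
    ring
  rw [← this]
  ring

theorem hasExpansion_shadow {n : ℕ} {P : Polynomial ℂ} (hP : P.natDegree ≤ 5) {S : ℂ → ℂ}
    (hS : ∀ τ : ℂ, 0 < τ.im → S τ = theta2 τ ^ n * P.eval (hauptShadow τ)) :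
    ∃ c : ℂ, HasExpansion (fun τ ↦ cexp (-(Real.pi * I * τ * ((n - 8 * (5 : ℕ)) / 4))) * S τ)
      (2 ^ n * ((-1 / 4096) ^ 5 * P.coeff 5)) 0
      (2 ^ n * ((n - 120) * ((-1 / 4096) ^ 5 * P.coeff 5) + (-1 / 4096) ^ 4 * P.coeff 4)) 0 c :=
  ⟨_, ((((hasExpansion_normTheta2_pow n).mul (hasExpansion_eval_hauptShadow hP)).const_mul
    (2 ^ n)).congr_fun fun τ hτ ↦ by
      rw [hS τ hτ, ← mul_assoc (cexp _), cexp_mul_theta2_pow]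
      ring).congr_coeff (by ring) (by ring) (by ring) (by ring) rfl⟩

section Lattice

variable {n : ℕ} {Λ : Submodule ℤ (EuclideanSpace ℝ (Fin n))} [DiscreteTopology Λ] [IsZLattice ℝ Λ]

/-- The top coefficient vanishes if there are no characteristic vectors of norm `n - 40`. -/
theorem coeff_five_eq_zero (hΛ : IsUnimodular Λ) {w : EuclideanSpace ℝ (Fin n)}
    (hw : IsCharacteristic Λ w) (hne : ∀ v, IsCharacteristic Λ v → (n - 39 : ℝ) ≤ ⟪v, v⟫_ℝ)
    {P : Polynomial ℂ} (hP : P.natDegree ≤ 5) (hS : ∀ τ : ℂ, 0 < τ.im →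
      translateTheta Λ ((1 / 2 : ℝ) • w) τ = theta2 τ ^ n * P.eval (hauptShadow τ)) :
    P.coeff 5 = 0 := by
  obtain ⟨c, hc⟩ := hasExpansion_shadow hP hS
  have hle : ∀ x ∈ Λ, (n - 39 : ℝ) / 4 ≤ ‖x + (1 / 2 : ℝ) • w‖ ^ 2 :=
    fun _ hx ↦ div_four_le_norm_sq_shadow hΛ hne hw hx
  have hO := (isBigO_refl (fun τ : ℂ ↦ cexp (-(Real.pi * I * τ * ((n - 8 * (5 : ℕ)) / 4))))
    (comap im atTop)).mul (isBigO_ofReal_right.2 (isBigO_translateTheta _ hle))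
  -- The shadow norms are at least (n − 39)/4, which leaves decay at rate 1/4 after normalisation by
  -- (n − 40)/4.
  have hlim := hO.trans_tendsto (g'' := fun τ ↦ _) (by
    rw [tendsto_zero_iff_norm_tendsto_zero]
    refine (tendsto_exp_neg_im (c := 1 / 4) (by norm_num)).congr fun τ ↦ ?_
    rw [norm_mul, Complex.norm_real, Real.norm_of_nonneg (Real.exp_pos _).le,
      show -(Real.pi * I * τ * ((n - 8 * (5 : ℕ)) / 4)) =
        Real.pi * I * τ * ((-((n - 40) / 4) : ℝ) : ℂ) by push_cast; ring, norm_cexp_pi_mul,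
      ← Real.exp_add]
    congr 1
    ring)
  have h0 := tendsto_nhds_unique hc.tendsto hlim
  simpa using h0

/-- The top coefficient if there is a characteristic vector of norm `n - 40`. -/
theorem exists_coeff_five_eq (hΛ : IsNSubEightKLattice 5 Λ) (h3 : ∀ x ∈ Λ, x ≠ 0 → 3 < ‖x‖ ^ 2)
    {w : EuclideanSpace ℝ (Fin n)} (hw : IsCharacteristic Λ w) (hw' : ⟪w, w⟫_ℝ = n - 40)
    {P : Polynomial ℂ} (hP : P.natDegree ≤ 5) (hS : ∀ τ : ℂ, 0 < τ.im →
      translateTheta Λ ((1 / 2 : ℝ) • w) τ = theta2 τ ^ n * P.eval (hauptShadow τ)) {a : ℝ}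
    (ha : P.coeff 4 = a) (ha0 : 0 ≤ a) :
    ∃ μ : ℝ, P.coeff 5 = (-2 ^ 60 * μ : ℝ) ∧ μ * (n - 119) ≤ 1 := by
  obtain ⟨m₀, m₁, m₂, m₃, m₄, hm, h⟩ := hasExpansion_translateTheta_shadow hΛ h3 hw
    (by rw [hw']; norm_num)
  obtain ⟨c, hc⟩ := hasExpansion_shadow hP hS
  obtain ⟨e0, -, e2, -, -⟩ := hc.unique h
  have h2n : (2 : ℝ) ^ n ≠ 0 := by positivity
  have h2n' : (2 : ℂ) ^ n ≠ 0 := pow_ne_zero _ two_ne_zero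
  -- Here 4096⁵ = 2⁶⁰; in the q² coefficient below, 4096⁴ = 2⁴⁸.
  have h5 : P.coeff 5 = (-2 ^ 60 * (m₀ / 2 ^ n) : ℝ) := by
    push_cast
    field_simp
    linear_combination -2 ^ 60 * e0
  refine ⟨m₀ / 2 ^ n, h5, ?_⟩
  rw [h5, ha] at e2
  have e2' : (2 : ℝ) ^ n * ((n - 120) * (m₀ / 2 ^ n) + a / 2 ^ 48) = m₂ := by
    apply ofReal_injective
    push_cast at e2 ⊢
    rw [← e2]
    ring
  have hm' : (m₀ : ℝ) + m₂ ≤ 2 ^ n := by exact_mod_cast hm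
  rw [← e2'] at hm'
  have hpos : (0 : ℝ) < 2 ^ n := by positivity
  -- Adding m₀ = 2ⁿμ to m₂ turns n − 120 into n − 119; the term with a is then dropped by its sign.
  have h6 : (2 : ℝ) ^ n * (m₀ / 2 ^ n * (n - 119) + a / 2 ^ 48) ≤ 2 ^ n * 1 := by
    refine le_trans (le_of_eq ?_) (hm'.trans (le_of_eq (mul_one _).symm))
    field_simp
    ring
  have h7 := le_of_mul_le_mul_left h6 hpos
  have : 0 ≤ a / 2 ^ 48 := by positivity
  linarith

/-- Either some characteristic vector has norm n − 40 and the layer count applies, or integrality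
raises the minimum to n − 39 and μ = 0. The value a stays free because coefficient 4 is computed
only once P is known. -/
theorem exists_coeff_five_bound (hΛ : IsNSubEightKLattice 5 Λ)
    (h3 : ∀ x ∈ Λ, x ≠ 0 → 3 < ‖x‖ ^ 2) :
    ∃ P : Polynomial ℂ, P.natDegree ≤ 5 ∧
      (∀ τ : ℂ, 0 < τ.im → translateTheta Λ 0 τ = jacobiTheta τ ^ n * P.eval (haupt τ)) ∧
      ∀ a : ℝ, P.coeff 4 = a → 0 ≤ a →
        ∃ μ : ℝ, P.coeff 5 = (-2 ^ 60 * μ : ℝ) ∧ μ * (n - 119) ≤ 1 := by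
  by_cases hex : ∃ w, IsCharacteristic Λ w ∧ ⟪w, w⟫_ℝ = n - 40
  · obtain ⟨w, hw, hw'⟩ := hex
    obtain ⟨P, hP, h⟩ := exists_polynomial_translateTheta hΛ hw
    exact ⟨P, hP, fun τ hτ ↦ (h τ hτ).1, fun a ha ha0 ↦
      exists_coeff_five_eq hΛ h3 hw hw' hP (fun τ hτ ↦ (h τ hτ).2) ha ha0⟩
  · obtain ⟨w, hw⟩ := exists_isCharacteristic hΛ.1
    obtain ⟨P, hP, h⟩ := exists_polynomial_translateTheta hΛ hw
    refine ⟨P, hP, fun τ hτ ↦ (h τ hτ).1, fun a _ _ ↦ ⟨0, ?_, by simp⟩⟩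
    rw [coeff_five_eq_zero hΛ.1 hw ?_ hP fun τ hτ ↦ (h τ hτ).2]
    · simp
    · intro v hv
      obtain ⟨j, hj⟩ := hΛ.1.1 v hv.1 v hv.1
      have h1 := hΛ.2 v hv
      have h2 : ⟪v, v⟫_ℝ ≠ n - 40 := fun h ↦ hex ⟨v, hv, h⟩
      rw [hj] at h1 h2 ⊢
      have h1' : (n : ℤ) - 40 ≤ j := by
        have : ((n - 40 : ℤ) : ℝ) ≤ j := by push_cast at h1 ⊢; linarith
        exact_mod_cast this
      have h2' : (j : ℤ) ≠ n - 40 := by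
        intro h
        apply h2
        rw [h]
        push_cast
        ring
      have h3' : (n : ℤ) - 39 ≤ j := by omega
      exact_mod_cast h3'

end Lattice

/-- The last term is −2³⁰μ, below 10⁵ in size when μ > 0, whereas the quartic in n is of order 10⁹
already at n = 12885. -/
theorem one_lt_of_mul_sub_le_one {n N μ : ℝ} (hn : 12885 ≤ n) (hN : 0 ≤ N) (hμ : μ * (n - 119) ≤ 1) :
    1 < 1 + -2 * n * (1 / 64) + (2 * n ^ 2 - 46 * n) * (1 / 64) ^ 2 +
      (-4 / 3 * n ^ 3 + 92 * n ^ 2 - 4832 / 3 * n) * (1 / 64) ^ 3 +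
      (2 / 3 * n ^ 4 - 92 * n ^ 3 + 12838 / 3 * n ^ 2 - 67118 * n + N) * (1 / 64) ^ 4 +
      -2 ^ 60 * μ * (1 / 64) ^ 5 := by
  -- Expanded around 12885, the quartic part has only positive coefficients in k.
  obtain ⟨k, rfl⟩ : ∃ k, n = 12885 + k := ⟨n - 12885, by ring⟩
  have hk : 0 ≤ k := by linarith
  have hμ' : μ ≤ 1 := by
    by_contra! h
    nlinarith
  have h2 : 0 ≤ k ^ 2 := by positivity
  have h3 : 0 ≤ k ^ 3 := by positivity
  have h4 : 0 ≤ k ^ 4 := by positivity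
  -- 12766 = 12885 − 119.
  have hμ'' : μ ≤ 1 / 12766 := by
    rw [le_div_iff₀ (by norm_num)]
    by_contra! h
    nlinarith
  nlinarith

end BelfioreSole

open BelfioreSole in
theorem mainTheorem9 (hBS : BelfioreSole.BelfioreSoleConjecture) (n : ℕ) (hn : 12885 ≤ n) :
    ¬ ∃ (Λ : Submodule ℤ (EuclideanSpace ℝ (Fin n)))
        (_ : DiscreteTopology Λ) (_ : IsZLattice ℝ Λ),
      BelfioreSole.IsNSubEightKLattice 5 Λ ∧ ¬ ∃ x ∈ Λ, x ≠ 0 ∧ ⟪x, x⟫_ℝ ≤ 3 := by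
  rintro ⟨Λ, _, _, hΛ, h⟩
  have h3 : ∀ x ∈ Λ, x ≠ 0 → 3 < ‖x‖ ^ 2 := by
    intro x hx hx0
    rw [← real_inner_self_eq_norm_sq]
    by_contra! h'
    exact h ⟨x, hx, hx0, h'⟩
  have hn' : (12885 : ℝ) ≤ n := by exact_mod_cast hn
  obtain ⟨N, hN⟩ := hasExpansion_translateTheta_zero hΛ.1 h3
  obtain ⟨P, hP, hPτ, h5⟩ := exists_coeff_five_bound hΛ h3
  obtain ⟨e0, e1, e2, e3, e4⟩ := coeff_eq_of_hasExpansion hP (hN.congr_fun hPτ)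
  obtain ⟨μ, e5, hμ⟩ := h5
    (2 / 3 * n ^ 4 - 92 * n ^ 3 + 12838 / 3 * n ^ 2 - 67118 * n + N) (by rw [e4]; push_cast; ring)
    (by
      have hN0 : (0 : ℝ) ≤ N := Nat.cast_nonneg _
      -- The same shift shows that coefficient 4 is nonnegative.
      obtain ⟨k, hk⟩ : ∃ k : ℝ, (n : ℝ) = 12885 + k := ⟨n - 12885, by ring⟩
      rw [hk] at hn' ⊢
      have hk0 : 0 ≤ k := by linarith
      have h2 : 0 ≤ k ^ 2 := by positivity
      have h3 : 0 ≤ k ^ 3 := by positivity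
      have h4 : 0 ≤ k ^ 4 := by positivity
      linarith)
  have hle := hBS.theta_one_le hΛ.1 hN.tendsto
  have hI : 0 < Complex.I.im := by simp
  have hev : P.eval (1 / 64) =
      ((1 + -2 * n * (1 / 64) + (2 * n ^ 2 - 46 * n) * (1 / 64) ^ 2 +
      (-4 / 3 * n ^ 3 + 92 * n ^ 2 - 4832 / 3 * n) * (1 / 64) ^ 3 +
      (2 / 3 * n ^ 4 - 92 * n ^ 3 + 12838 / 3 * n ^ 2 - 67118 * n + N) * (1 / 64) ^ 4 +
      -2 ^ 60 * μ * (1 / 64) ^ 5 : ℝ) : ℂ) := by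
    rw [Polynomial.eval_eq_sum_range' (Nat.lt_succ_of_le hP)]
    simp only [Finset.sum_range_succ, Finset.sum_range_zero, e0, e1, e2, e3, e4, e5]
    push_cast
    ring
  have hlt := one_lt_of_mul_sub_le_one hn' (Nat.cast_nonneg N) hμ
  have heq : theta Λ 1 = theta (intLattice n) 1 * (1 + -2 * n * (1 / 64) +
      (2 * n ^ 2 - 46 * n) * (1 / 64) ^ 2 +
      (-4 / 3 * n ^ 3 + 92 * n ^ 2 - 4832 / 3 * n) * (1 / 64) ^ 3 +
      (2 / 3 * n ^ 4 - 92 * n ^ 3 + 12838 / 3 * n ^ 2 - 67118 * n + N) * (1 / 64) ^ 4 +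
      -2 ^ 60 * μ * (1 / 64) ^ 5) := by
    apply Complex.ofReal_injective
    rw [Complex.ofReal_mul, ← hev, ofReal_theta, ofReal_theta, Complex.ofReal_one, one_mul,
      hPτ _ hI, translateTheta_intLattice hI, haupt_I]
  have hpos : 0 < theta (intLattice n) 1 := by
    refine lt_of_le_of_ne (tsum_nonneg fun _ ↦ (Real.exp_pos _).le) fun h0 ↦ ?_
    have h1 := ofReal_theta (Λ := intLattice n) 1
    rw [← h0, Complex.ofReal_one, one_mul, translateTheta_intLattice hI] at h1
    exact pow_ne_zero n (jacobiTheta_ne_zero hI) (by simpa using h1.symm)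
  rw [heq] at hle
  have := mul_lt_mul_of_pos_left hlt hpos
  linarith
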